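/- Let $A_1,\dots,A_7$ be copies of $\mathbb C^2$, and let the lines of the Fano plane on the points $1,\dots,7$ be $123,145,167,246,257,347,356$. Put $A_{ijk}=A_i\otimes A_j\otimes A_k$ and $V=\bigoplus_{ijk}A_{ijk}$, the sum over the seven lines. Let $V$ carry the structure of the minimal ($56$-dimensional) representation of the complex Lie algebra $\mathfrak e_7$ given by the model $\mathfrak e_7=\times_{i}\mathfrak{sl}(A_i)\oplus\bigoplus_{\ell}\bigotimes_{i\notin\ell}A_i$, in which the subalgebra $\times_i\mathfrak{sl}(A_i)$ acts on each $A_{ijk}$ in the natural way. Let $E_7\subset GL(V)$ be the group generated by $\exp(\mathfrak e_7)$, let $T\subset E_7$ be its maximal torus, let $N(T)$ be the normalizer of $T$ in $E_7$, and let $W(E_7)=N(T)/T$. Call a quartic form on $V$ $W(E_7)$-invariant if it is $T$-invariant and fixed by the induced action of $W(E_7)$ on $T$-invariant forms, that is, if it is $N(T)$-invariant. Then there is a nonzero $E_7$-invariant quartic form $Q$ on $V$; it is unique up to scalars; its restriction to each $A_{ijk}$ is a nonzero multiple of Cayley's hyperdeterminant; and $Q$ is, up to scalars, the unique $W(E_7)$-invariant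 quartic form whose restriction to each $A_{ijk}$ is proportional to Cayley's hyperdeterminant: a quartic form $q$ on $V$ is $W(E_7)$-invariant with every restriction $q|_{A_{ijk}}$ a (possibly zero) multiple of the hyperdeterminant if and only if $q\in\mathbb C\,Q$. -/

import Mathlib

/-! ### The Fano plane, the module `V = ⨁_ℓ A_i ⊗ A_j ⊗ A_k` and its weights -/

namespace FanoE7

attribute [local instance 100] LieRing.ofAssociativeRing

/-- The seven lines `123, 145, 167, 246, 257, 347, 356` of the Fano plane
(the points `1, …, 7` are written `0, …, 6`). -/
def line : Fin 7 → Fin 3 → Fin 7 :=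
  ![![0, 1, 2], ![0, 3, 4], ![0, 5, 6], ![1, 3, 5], ![1, 4, 6], ![2, 3, 6], ![2, 4, 5]]

/-- Indices of the coordinates of `A_i ⊗ A_j ⊗ A_k`, where each `A_i` is `ℂ²`: the coordinate `s`
is the coefficient of `e_{s 0} ⊗ e_{s 1} ⊗ e_{s 2}`. -/
abbrev Cube : Type := Fin 3 → Fin 2

/-- The weight basis of `V`: a line `ℓ`, and a basis vector of `⊗_{i ∈ ℓ} A_i`. -/
abbrev Idx : Type := Fin 7 × Cube

/-- The 56-dimensional space `V = ⨁_ℓ ⊗_{i ∈ ℓ} A_i`, in coordinates. -/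
abbrev V : Type := Idx → ℂ

/-- The inclusion of the factor `A_{ijk}`, `{i, j, k} = ℓ`, in `V`. -/
def incl (ℓ : Fin 7) (a : Cube → ℂ) : V := fun m => if m.1 = ℓ then a m.2 else 0

/-- The weight of a basis vector of `V` for the diagonal torus of `SL(A_1) × ⋯ × SL(A_7)`:
in `A_i` the vector `e_0` has weight `1` and `e_1` has weight `-1`. -/
def wt (m : Idx) (i : Fin 7) : ℤ :=
  ∑ p : Fin 3, if line m.1 p = i then (if m.2 p = 0 then 1 else -1) else 0

/-- The action on `V` of `X ∈ 𝔤𝔩(A_i)`: it acts on the factor `A_i` of each `⊗_{j ∈ ℓ} A_j` with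
`i ∈ ℓ`, and by zero on the `⊗_{j ∈ ℓ} A_j` with `i ∉ ℓ`. -/
def slAct (i : Fin 7) (X : Matrix (Fin 2) (Fin 2) ℂ) : Matrix Idx Idx ℂ := fun m n =>
  if m.1 = n.1 then
    ∑ p : Fin 3, if line n.1 p = i ∧ ∀ q, q ≠ p → m.2 q = n.2 q then X (m.2 p) (n.2 p) else 0
  else 0

/-! ### The Lie algebra `𝔢₇` and its action on `V` -/

/-- The multiplication table of the imaginary octonions, `e_α e_ℓ = θ_{α ℓ} e_{α + ℓ}` for lines
`α ≠ ℓ`, where `α + ℓ` is the third line through the common point of `α` and `ℓ`. -/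
def theta : Matrix (Fin 7) (Fin 7) ℤ :=
  !![ 0,  1, -1,  1, -1,  1, -1;
     -1,  0,  1, -1,  1,  1, -1;
      1, -1,  0,  1,  1, -1, -1;
     -1,  1, -1,  0,  1, -1,  1;
      1, -1, -1, -1,  0,  1,  1;
     -1, -1,  1,  1, -1,  0,  1;
      1,  1,  1, -1, -1, -1,  0]

/-- The element of weight `2` (if `ε = 1`) or `-2` (if `ε = -1`) of `𝔰𝔩(A_i)`, acting on `V`:
it sends `e_1` to `e_0`, respectively `e_0` to `e_1`, in the factor `A_i`. -/
def slOp (i : Fin 7) (ε : ℤ) : Matrix Idx Idx ℤ := fun m n =>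
  if wt m = wt n + Pi.single i (2 * ε) then 1 else 0

/-- The action on `V` of the basis vector `x = ⊗_{i ∉ α} x_i` of `⊗_{i ∉ α} A_i` whose weight is
`β`, a function with values `±1` off the line `α` and `0` on it. A tensor `⊗_{i ∈ ℓ} y_i`, where
`ℓ ≠ α` meets `α` in the point `k`, is sent to
`θ_{α ℓ} ∏_{i ∈ ℓ, i ≠ k} ω(x_i, y_i) · (y_k ⊗ ⊗_{j ∉ α ∪ ℓ} x_j)`, where `ω(e_0, e_1) = 1`; for
basis vectors with nonzero image, `ω(x_i, y_i) = β i`. The factor `⊗_{i ∈ α} A_i` is sent to `0`. -/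
def quadOp (α : Fin 7) (β : Fin 7 → ℤ) : Matrix Idx Idx ℤ := fun m n =>
  if wt m = wt n + β then
    theta α n.1 * ∏ p : Fin 3, if ∃ q, line α q = line n.1 p then 1 else β (line n.1 p)
  else 0

/-- The operators of the simple root vectors (`ε = 1`) and of their opposites (`ε = -1`),
numbered as the rows of `CartanMatrix.E₇`. -/
def chev (ε : ℤ) : Fin 7 → Matrix Idx Idx ℤ :=
  ![quadOp 1 (ε • ![0, -1, 1, 0, 0, -1, -1]), slOp 0 ε, slOp 1 ε,
    quadOp 6 (ε • ![-1, -1, 0, -1, 0, 0, 1]), slOp 3 ε,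
    quadOp 0 (ε • ![0, 0, 0, -1, -1, 1, -1]), slOp 4 ε]

/-- The operators on `V` of the Chevalley generators of `𝔢₇`. -/
def genZ : CartanMatrix.Generators (Fin 7) → Matrix Idx Idx ℤ
  | .E i => chev 1 i
  | .F i => chev (-1) i
  | .H i => ⁅chev 1 i, chev (-1) i⁆

/-- The same operators with complex coefficients. -/
def gen (g : CartanMatrix.Generators (Fin 7)) : Matrix Idx Idx ℂ :=
  (Int.castRingHom ℂ).mapMatrix (genZ g)

/-! #### Verification of the Serre relations

The weight basis is numbered by `Fin 56`. Each generator is a matrix with at most one nonzero entry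
in each column, which is encoded by a partial map, and products of matrices become compositions of
partial maps. -/

/-- The numbering of the weight basis. -/
def code : Idx ≃ Fin 56 where
  toFun m := Fin.ofNat 56 (8 * m.1.val + 4 * (m.2 0).val + 2 * (m.2 1).val + (m.2 2).val)
  invFun k := (Fin.ofNat 7 (k.val / 8),
    ![Fin.ofNat 2 (k.val / 4), Fin.ofNat 2 (k.val / 2), Fin.ofNat 2 k.val])
  left_inv := by decide +kernel
  right_inv := by decide +kernel

/-- Partial maps with coefficients. -/
abbrev PMap : Type := Fin 56 → Option (Fin 56 × ℤ)

/-- The matrix encoded by a partial map with coefficients. -/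
def toM (P : PMap) : Matrix (Fin 56) (Fin 56) ℤ := fun m n =>
  match P n with
  | none => 0
  | some (k, c) => if m = k then c else 0

/-- Composition of partial maps with coefficients. -/
def comp (P Q : PMap) (n : Fin 56) : Option (Fin 56 × ℤ) :=
  match Q n with
  | none => none
  | some (k, c) =>
    match P k with
    | none => none
    | some (l, d) => some (l, d * c)

theorem toM_mul (P Q : PMap) : toM P * toM Q = toM (comp P Q) := by
  ext m n
  rw [Matrix.mul_apply]
  simp only [toM, comp]
  rcases hQ : Q n with _ | ⟨k, c⟩
  · simp
  · simp only [mul_ite, mul_zero, Finset.sum_ite_eq', Finset.mem_univ, if_true]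
    rcases hP : P k with _ | ⟨l, d⟩
    · simp
    · simp

/-- The nonzero entries of the operators of the simple root vectors: column, row, value. -/
def entries : Fin 7 → List (ℕ × ℕ × ℤ) :=
  ![ [(1, 19, 1), (5, 23, 1), (16, 2, 1), (20, 6, 1), (24, 41, -1), (26, 43, -1), (32, 49, 1),
     (34, 51, 1), (44, 29, -1), (46, 31, -1), (52, 37, 1), (54, 39, 1)],
    [(4, 0, 1), (5, 1, 1), (6, 2, 1), (7, 3, 1), (12, 8, 1), (13, 9, 1), (14, 10, 1), (15, 11,
     1), (20, 16, 1), (21, 17, 1), (22, 18, 1), (23, 19, 1)],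
    [(2, 0, 1), (3, 1, 1), (6, 4, 1), (7, 5, 1), (28, 24, 1), (29, 25, 1), (30, 26, 1), (31, 27,
     1), (36, 32, 1), (37, 33, 1), (38, 34, 1), (39, 35, 1)],
    [(0, 42, 1), (1, 46, 1), (8, 36, 1), (9, 38, 1), (17, 30, -1), (19, 31, -1), (24, 20, -1),
     (25, 22, -1), (33, 14, 1), (35, 15, 1), (41, 6, 1), (45, 7, 1)],
    [(10, 8, 1), (11, 9, 1), (14, 12, 1), (15, 13, 1), (26, 24, 1), (27, 25, 1), (30, 28, 1),
     (31, 29, 1), (42, 40, 1), (43, 41, 1), (46, 44, 1), (47, 45, 1)],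
    [(8, 17, 1), (12, 21, 1), (18, 11, 1), (22, 15, 1), (25, 35, -1), (29, 39, -1), (32, 26,
     -1), (36, 30, -1), (40, 50, 1), (44, 54, 1), (49, 43, 1), (53, 47, 1)],
    [(9, 8, 1), (11, 10, 1), (13, 12, 1), (15, 14, 1), (34, 32, 1), (35, 33, 1), (38, 36, 1),
     (39, 37, 1), (50, 48, 1), (51, 49, 1), (54, 52, 1), (55, 53, 1)]]

/-- The partial maps of the simple root vectors (`b = true`) and of their opposites. -/
def chevP (b : Bool) (i : Fin 7) : PMap := fun n =>
  if b then ((entries i).find? fun a => a.1 == n.val).map fun a => (Fin.ofNat 56 a.2.1, a.2.2)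
  else ((entries i).find? fun a => a.2.1 == n.val).map fun a => (Fin.ofNat 56 a.1, a.2.2)

/-- The sign `1` or `-1` encoded by a Boolean. -/
def sg (b : Bool) : ℤ := if b then 1 else -1

/-- A linear form that separates the weights. -/
def lin (v : Fin 7 → ℤ) : ℤ :=
  v 0 + 5 * v 1 + 25 * v 2 + 125 * v 3 + 625 * v 4 + 3125 * v 5 + 15625 * v 6

/-- The values of the linear form on the weights. -/
def linWt : List ℤ :=
  [31, -19, 21, -29, 29, -21, 19, -31, 751, -499, 501, -749, 749, -501, 499, -751, 18751,
   -12499, 12501, -18749, 18749, -12501, 12499, -18751, 3255, -2995, 3005, -3245, 3245, -3005,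
   2995, -3255, 16255, -14995, 15005, -16245, 16245, -15005, 14995, -16255, 15775, -15475,
   15525, -15725, 15725, -15525, 15475, -15775, 3775, -2475, 2525, -3725, 3725, -2525, 2475,
   -3775]

theorem lin_wt : ∀ k : Fin 56, linWt[k.val]? = some (lin (wt (code.symm k))) := by decide +kernel

theorem lin_mem (m : Idx) : lin (wt m) ∈ linWt := by
  have := lin_wt (code m)
  rw [Equiv.symm_apply_apply] at this
  exact List.mem_of_getElem? this

theorem linWt_nodup : linWt.Nodup := by decide +kernel

theorem lin_inj (m n : Idx) (h : lin (wt m) = lin (wt n)) : m = n := by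
  have h1 := lin_wt (code m)
  have h2 := lin_wt (code n)
  rw [Equiv.symm_apply_apply] at h1 h2
  rw [← h] at h2
  obtain ⟨h1', h1⟩ := List.getElem?_eq_some_iff.1 h1
  obtain ⟨h2', h2⟩ := List.getElem?_eq_some_iff.1 h2
  have := (linWt_nodup.getElem_inj_iff (hi := h1') (hj := h2')).1 (h1.trans h2.symm)
  exact code.injective (Fin.ext this)

theorem lin_add (v w : Fin 7 → ℤ) : lin (v + w) = lin v + lin w := by
  simp only [lin, Pi.add_apply]
  ring

/-- A matrix whose nonzero entries shift weights by `β` is encoded by a partial map `P`. -/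
theorem eq_toM (β : Fin 7 → ℤ) (c : Idx → ℤ) (P : PMap)
    (hn : ∀ n, P n = none → lin (wt (code.symm n)) + lin β ∉ linWt)
    (hs : ∀ n, ∀ a ∈ P n, wt (code.symm a.1) = wt (code.symm n) + β ∧ c (code.symm n) = a.2) :
    (fun m n => if wt m = wt n + β then c n else 0 : Matrix Idx Idx ℤ) =
      (toM P).submatrix code code := by
  ext m n
  simp only [toM, Matrix.submatrix_apply]
  rcases h : P (code n) with _ | ⟨k, d⟩
  · simp only
    rw [if_neg]
    intro h'
    apply hn _ h
    rw [Equiv.symm_apply_apply, ← lin_add, ← h']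
    exact lin_mem m
  · obtain ⟨h1, h2⟩ := hs (code n) (k, d) (by simp [h])
    rw [Equiv.symm_apply_apply] at h1 h2
    simp only at h1 h2 ⊢
    rw [← h1, h2]
    have : wt m = wt (code.symm k) ↔ code m = k := by
      constructor
      · intro e
        rw [lin_inj _ _ (congrArg lin e), Equiv.apply_symm_apply]
      · rintro rfl
        rw [Equiv.symm_apply_apply]
    simp only [this]

/-- The weights of the simple roots. -/
def root : Fin 7 → Fin 7 → ℤ :=
  ![![0, -1, 1, 0, 0, -1, -1], Pi.single 0 2, Pi.single 1 2, ![-1, -1, 0, -1, 0, 0, 1],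
    Pi.single 3 2, ![0, 0, 0, -1, -1, 1, -1], Pi.single 4 2]

/-- The coefficients of the operators `chev`. -/
def chevC (ε : ℤ) (i : Fin 7) (n : Idx) : ℤ :=
  let q (α : Fin 7) : ℤ := theta α n.1 *
    ∏ p : Fin 3, if ∃ q, line α q = line n.1 p then 1 else (ε • root i) (line n.1 p)
  (![q 1, 1, 1, q 6, 1, q 0, 1] : Fin 7 → ℤ) i

theorem check_none : ∀ b i n, chevP b i n = none →
    (linWt[n.val]?.getD 0) + sg b * lin (root i) ∉ linWt := by decide +kernel

theorem check_some : ∀ b i n, ∀ a ∈ chevP b i n,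
    wt (code.symm a.1) = wt (code.symm n) + sg b • root i ∧
      chevC (sg b) i (code.symm n) = a.2 := by decide +kernel

theorem lin_smul (ε : ℤ) (v : Fin 7 → ℤ) : lin (ε • v) = ε * lin v := by
  simp only [lin, Pi.smul_apply, smul_eq_mul]
  ring

theorem chev_eq' (ε : ℤ) (i : Fin 7) :
    chev ε i = fun m n => if wt m = wt n + ε • root i then chevC ε i n else 0 := by
  have h (j : Fin 7) : (Pi.single j (2 * ε) : Fin 7 → ℤ) = ε • Pi.single j 2 := by
    rw [← Pi.single_smul, smul_eq_mul, mul_comm]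
  have h' (j : Fin 7) : slOp j ε =
      fun m n => if wt m = wt n + ε • Pi.single j 2 then 1 else 0 := by
    funext m n
    rw [slOp, h]
  fin_cases i
  · rfl
  · exact h' 0
  · exact h' 1
  · rfl
  · exact h' 3
  · rfl
  · exact h' 4

theorem chev_eq (b : Bool) (i : Fin 7) :
    chev (sg b) i = (toM (chevP b i)).submatrix code code := by
  rw [chev_eq']
  apply eq_toM
  · intro n h
    have := check_none b i n h
    rw [lin_wt n, Option.getD_some, ← lin_smul] at this
    exact this
  · exact check_some b i

theorem toM_none (P : PMap) (h : ∀ n, P n = none) : toM P = 0 := by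
  ext m n
  simp [toM, h]

/-- The coefficient at `n` of a partial map, `0` where it is not defined. -/
def coef (P : PMap) (n : Fin 56) : ℤ :=
  match P n with
  | none => 0
  | some a => a.2

theorem toM_diag (P : PMap)
    (h : ∀ n, P n = none ∨ P n = some (n, coef P n)) : toM P = Matrix.diagonal (coef P) := by
  ext m n
  rw [Matrix.diagonal_apply]
  rcases h n with h | h
  · have : coef P n = 0 := by simp [coef, h]
    by_cases e : m = n
    · subst e
      simp [toM, h, this]
    · simp [toM, h, e]
  · by_cases e : m = n
    · subst e
      simp [toM, h]
    · simp [toM, h, e]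

/-- The diagonal entries of the operators of the coroots. -/
def corootP (i : Fin 7) (n : Fin 56) : ℤ :=
  coef (comp (chevP true i) (chevP false i)) n - coef (comp (chevP false i) (chevP true i)) n

theorem check_sq : ∀ i n, comp (chevP true i) (chevP true i) n = none ∧
    comp (chevP false i) (chevP false i) n = none := by decide +kernel

theorem check_ef : ∀ i j, i ≠ j → ∀ n, comp (chevP true i) (chevP false j) n =
    comp (chevP false j) (chevP true i) n := by decide +kernel

theorem check_diag : ∀ i n,
    (comp (chevP true i) (chevP false i) n = none ∨ comp (chevP true i) (chevP false i) n =
      some (n, coef (comp (chevP true i) (chevP false i)) n)) ∧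
    (comp (chevP false i) (chevP true i) n = none ∨ comp (chevP false i) (chevP true i) n =
      some (n, coef (comp (chevP false i) (chevP true i)) n)) := by decide +kernel

theorem check_weight : ∀ i j n,
    (∀ a ∈ chevP true j n, corootP i a.1 - corootP i n = CartanMatrix.E₇ i j) ∧
    (∀ a ∈ chevP false j n, corootP i a.1 - corootP i n = -CartanMatrix.E₇ i j) := by
  decide +kernel

/-- The entries of the Cartan matrix of type `E₇`. -/
def cartan (i j : Fin 7) : ℤ := CartanMatrix.E₇ i j

theorem check_comm : ∀ i j, cartan i j = 0 → ∀ n,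
    comp (chevP true i) (chevP true j) n = comp (chevP true j) (chevP true i) n ∧
    comp (chevP false i) (chevP false j) n = comp (chevP false j) (chevP false i) n := by
  decide +kernel

theorem check_adj : ∀ i j, cartan i j = -1 → ∀ n,
    comp (comp (chevP true i) (chevP true j)) (chevP true i) n = none ∧
    comp (comp (chevP false i) (chevP false j)) (chevP false i) n = none := by
  decide +kernel

theorem check_cartan : ∀ i j, i = j ∨ cartan i j = 0 ∨ cartan i j = -1 := by
  decide

theorem sub_mul_sub (A B : Matrix (Fin 56) (Fin 56) ℤ) :
    A.submatrix code code * B.submatrix code code = (A * B).submatrix code code :=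
  Matrix.submatrix_mul_equiv A B code code code

theorem coroot_eq (i : Fin 7) :
    ⁅chev 1 i, chev (-1) i⁆ = Matrix.diagonal (corootP i ∘ code) := by
  change ⁅chev (sg true) i, chev (sg false) i⁆ = _
  rw [Ring.lie_def, chev_eq, chev_eq, sub_mul_sub, sub_mul_sub, toM_mul, toM_mul,
    toM_diag _ fun n => (check_diag i n).1, toM_diag _ fun n => (check_diag i n).2,
    Matrix.submatrix_diagonal_equiv, Matrix.submatrix_diagonal_equiv, Matrix.diagonal_sub]
  rfl

theorem lie_diagonal_toM (d : Fin 56 → ℤ) (P : PMap) (c : ℤ)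
    (h : ∀ n, ∀ a ∈ P n, d a.1 - d n = c) :
    ⁅Matrix.diagonal (d ∘ code), (toM P).submatrix code code⁆ =
      c • (toM P).submatrix code code := by
  ext m n
  rw [Ring.lie_def, Matrix.sub_apply, Matrix.diagonal_mul, Matrix.mul_diagonal, Matrix.smul_apply]
  simp only [toM, Matrix.submatrix_apply, Function.comp_apply]
  rcases hP : P (code n) with _ | ⟨k, b⟩
  · simp
  · by_cases e : code m = k
    · have := h (code n) (k, b) (by simp [hP])
      simp only [e, if_true, smul_eq_mul, ← this]
      ring
    · simp [e]

theorem lie_lie_eq_zero {R : Type*} [Ring R] (x y : R) (h : x * x = 0) (h' : x * y * x = 0) :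
    ⁅x, ⁅x, y⁆⁆ = 0 := by
  have : ⁅x, ⁅x, y⁆⁆ = (x * x) * y - x * y * x - x * y * x + y * (x * x) := by
    simp only [Ring.lie_def]
    noncomm_ring
  rw [this, h, h']
  simp

theorem serre_adj (b : Bool) (i j : Fin 7) :
    ((fun z => ⁅chev (sg b) i, z⁆)^[(-CartanMatrix.E₇ i j).toNat])
      ⁅chev (sg b) i, chev (sg b) j⁆ = 0 := by
  change ((fun z => ⁅chev (sg b) i, z⁆)^[(-cartan i j).toNat]) _ = 0
  rcases check_cartan i j with h | h | h
  · subst h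
    rw [lie_self]
    exact Function.iterate_fixed (lie_zero _) _
  · rw [h]
    have : chev (sg b) i * chev (sg b) j = chev (sg b) j * chev (sg b) i := by
      rw [chev_eq, chev_eq, sub_mul_sub, sub_mul_sub, toM_mul, toM_mul]
      congr 2
      funext n
      cases b
      · exact (check_comm i j h n).2
      · exact (check_comm i j h n).1
    simp [Ring.lie_def, this]
  · rw [h]
    change ⁅chev (sg b) i, ⁅chev (sg b) i, chev (sg b) j⁆⁆ = 0
    apply lie_lie_eq_zero
    · rw [chev_eq, sub_mul_sub, toM_mul, toM_none, Matrix.submatrix_zero]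
      · rfl
      · intro n
        cases b
        · exact (check_sq i n).2
        · exact (check_sq i n).1
    · rw [chev_eq, chev_eq, sub_mul_sub, sub_mul_sub, toM_mul, toM_mul, toM_none,
        Matrix.submatrix_zero]
      · rfl
      · intro n
        cases b
        · exact (check_adj i j h n).2
        · exact (check_adj i j h n).1

theorem lie_chev (i j : Fin 7) (h : i ≠ j) : ⁅chev 1 i, chev (-1) j⁆ = 0 := by
  change ⁅chev (sg true) i, chev (sg false) j⁆ = 0
  rw [Ring.lie_def, chev_eq, chev_eq, sub_mul_sub, sub_mul_sub, toM_mul, toM_mul, sub_eq_zero]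
  congr 2
  funext n
  exact check_ef i j h n

theorem lie_HE (i j : Fin 7) :
    ⁅⁅chev 1 i, chev (-1) i⁆, chev 1 j⁆ = CartanMatrix.E₇ i j • chev 1 j := by
  rw [coroot_eq]
  change ⁅_, chev (sg true) j⁆ = _ • chev (sg true) j
  rw [chev_eq]
  exact lie_diagonal_toM _ _ _ fun n => (check_weight i j n).1

theorem lie_HF (i j : Fin 7) :
    ⁅⁅chev 1 i, chev (-1) i⁆, chev (-1) j⁆ = -(CartanMatrix.E₇ i j • chev (-1) j) := by
  rw [coroot_eq, ← neg_smul]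
  change ⁅_, chev (sg false) j⁆ = _ • chev (sg false) j
  rw [chev_eq]
  exact lie_diagonal_toM _ _ _ fun n => (check_weight i j n).2

theorem gen_lie (x y : Matrix Idx Idx ℤ) :
    (Int.castRingHom ℂ).mapMatrix ⁅x, y⁆ =
      ⁅(Int.castRingHom ℂ).mapMatrix x, (Int.castRingHom ℂ).mapMatrix y⁆ := by
  simp only [Ring.lie_def, map_sub, map_mul]

/-- The operators `gen` extended to the free Lie algebra. -/
noncomputable def freeRep :
    FreeLieAlgebra ℂ (CartanMatrix.Generators (Fin 7)) →ₗ⁅ℂ⁆ Matrix Idx Idx ℂ :=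
  FreeLieAlgebra.lift ℂ gen

theorem freeRep_ad_pow (x z : FreeLieAlgebra ℂ (CartanMatrix.Generators (Fin 7)))
    (a c : Matrix Idx Idx ℤ) (hx : freeRep x = (Int.castRingHom ℂ).mapMatrix a)
    (hz : freeRep z = (Int.castRingHom ℂ).mapMatrix c) (k : ℕ) :
    freeRep ((LieAlgebra.ad ℂ _ x ^ k) z) =
      (Int.castRingHom ℂ).mapMatrix ((fun z => ⁅a, z⁆)^[k] c) := by
  induction k with
  | zero => simpa using hz
  | succ k ih =>
    rw [pow_succ', Module.End.mul_apply, LieAlgebra.ad_apply, LieHom.map_lie, ih, hx,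
      Function.iterate_succ_apply', gen_lie]

theorem freeRep_of (g : CartanMatrix.Generators (Fin 7)) :
    freeRep (FreeLieAlgebra.of ℂ g) = (Int.castRingHom ℂ).mapMatrix (genZ g) :=
  by
  rw [freeRep, FreeLieAlgebra.lift_of_apply]
  rfl

theorem relations_le_ker : CartanMatrix.Relations.toIdeal ℂ CartanMatrix.E₇ ≤ freeRep.ker := by
  unfold CartanMatrix.Relations.toIdeal
  rw [LieSubmodule.lieSpan_le]
  rintro _ (((((⟨⟨i, j⟩, rfl⟩ | ⟨⟨i, j⟩, rfl⟩) | ⟨⟨i, j⟩, rfl⟩) | ⟨⟨i, j⟩, rfl⟩) | ⟨⟨i, j⟩, rfl⟩) |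
    ⟨⟨i, j⟩, rfl⟩)
  all_goals rw [SetLike.mem_coe, LieHom.mem_ker]
  · simp only [CartanMatrix.Relations.HH, Function.uncurry_apply_pair, Function.comp_apply,
      LieHom.map_lie, freeRep_of, ← gen_lie, genZ, coroot_eq]
    simp [Ring.lie_def, mul_comm]
  · simp only [CartanMatrix.Relations.EF, Function.uncurry_apply_pair, Function.comp_apply]
    split
    · rename_i h
      subst h
      simp only [map_sub, LieHom.map_lie, freeRep_of, ← gen_lie, genZ, sub_self]
    · rename_i h
      simp only [LieHom.map_lie, freeRep_of, ← gen_lie, genZ, lie_chev i j h, map_zero]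
  · simp only [CartanMatrix.Relations.HE, Function.uncurry_apply_pair, Function.comp_apply,
      map_sub, LieHom.map_lie, freeRep_of, ← gen_lie, genZ, lie_HE]
    rw [map_zsmul freeRep, map_zsmul, freeRep_of]
    exact sub_self _
  · simp only [CartanMatrix.Relations.HF, Function.uncurry_apply_pair, Function.comp_apply,
      map_add, LieHom.map_lie, freeRep_of, ← gen_lie, genZ, lie_HF]
    rw [map_zsmul freeRep, map_neg, map_zsmul, freeRep_of]
    exact neg_add_cancel _
  · simp only [CartanMatrix.Relations.adE, Function.uncurry_apply_pair, Function.comp_apply]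
    rw [freeRep_ad_pow _ _ (chev 1 i) ⁅chev 1 i, chev 1 j⁆ (freeRep_of _)
      (by rw [LieHom.map_lie, freeRep_of, freeRep_of, gen_lie]; rfl)]
    exact (congrArg _ (serre_adj true i j)).trans (map_zero _)
  · simp only [CartanMatrix.Relations.adF, Function.uncurry_apply_pair, Function.comp_apply]
    rw [freeRep_ad_pow _ _ (chev (-1) i) ⁅chev (-1) i, chev (-1) j⁆ (freeRep_of _)
      (by rw [LieHom.map_lie, freeRep_of, freeRep_of, gen_lie]; rfl)]
    exact (congrArg _ (serre_adj false i j)).trans (map_zero _)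

/-- The action of the complex Lie algebra `𝔢₇` on its minimal representation `V`. -/
noncomputable def rep : LieAlgebra.e₇ ℂ →ₗ⁅ℂ⁆ Matrix Idx Idx ℂ where
  toLinearMap := Submodule.liftQ
    (CartanMatrix.Relations.toIdeal ℂ CartanMatrix.E₇).toSubmodule
    (freeRep : FreeLieAlgebra ℂ (CartanMatrix.Generators (Fin 7)) →ₗ[ℂ] Matrix Idx Idx ℂ)
    relations_le_ker
  map_lie' := by
    intro x y
    induction x using Submodule.Quotient.induction_on with | _ x
    induction y using Submodule.Quotient.induction_on with | _ y
    exact LieHom.map_lie freeRep x y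

/-! ### The group `E₇`, its maximal torus and its Weyl group -/

/-- The complex Lie group `E₇ ⊂ GL(V)`, generated by the exponentials of the elements of `𝔢₇`. -/
noncomputable def groupE7 : Subgroup (GL Idx ℂ) :=
  Subgroup.closure {g | ∃ x : LieAlgebra.e₇ ℂ, (g : Matrix Idx Idx ℂ) = NormedSpace.exp (rep x)}

/-- The maximal torus `T` of `E₇`, generated by the exponentials of the elements of the Cartan
subalgebra of `𝔢₇` that is spanned by the generators `H_i`. -/
noncomputable def torus : Subgroup (GL Idx ℂ) :=
  Subgroup.closure {g | ∃ c : Fin 7 → ℂ,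
    (g : Matrix Idx Idx ℂ) = NormedSpace.exp (∑ i, c i • gen (.H i))}

/-- The normalizer `N(T)` of `T` in `E₇`. The Weyl group is `W(E₇) = N(T) / T`. -/
noncomputable def torusNormalizer : Subgroup (GL Idx ℂ) :=
  groupE7 ⊓ Subgroup.normalizer (torus : Set (GL Idx ℂ))

/-! ### Quartic forms -/

/-- A polynomial function on `V` is invariant under a subgroup of `GL(V)`. -/
def IsInvariant (K : Subgroup (GL Idx ℂ)) (q : MvPolynomial Idx ℂ) : Prop :=
  ∀ g ∈ K, ∀ v : V, MvPolynomial.eval ((g : Matrix Idx Idx ℂ).mulVec v) q = MvPolynomial.eval v q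

/-- Invariance under `E₇`. -/
def IsE7Invariant (q : MvPolynomial Idx ℂ) : Prop := IsInvariant groupE7 q

/-- Invariance under `W(E₇) = N(T) / T`. The Weyl group does not act on `V`, only `N(T)` does; it
acts on the `T`-invariant forms, and the forms fixed by it are the `N(T)`-invariant ones. -/
def IsWeylInvariant (q : MvPolynomial Idx ℂ) : Prop := IsInvariant torusNormalizer q

/-- Cayley's hyperdeterminant of a `2 × 2 × 2` array. -/
def hyperdet (a : Cube → ℂ) : ℂ :=
  let x (i j k : Fin 2) : ℂ := a ![i, j, k]
  x 0 0 0 ^ 2 * x 1 1 1 ^ 2 + x 0 0 1 ^ 2 * x 1 1 0 ^ 2 +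
    x 0 1 0 ^ 2 * x 1 0 1 ^ 2 + x 1 0 0 ^ 2 * x 0 1 1 ^ 2 -
    2 * (x 0 0 0 * x 1 1 1 * x 0 0 1 * x 1 1 0 + x 0 0 0 * x 1 1 1 * x 0 1 0 * x 1 0 1 +
      x 0 0 0 * x 1 1 1 * x 1 0 0 * x 0 1 1 + x 0 0 1 * x 1 1 0 * x 0 1 0 * x 1 0 1 +
      x 0 0 1 * x 1 1 0 * x 1 0 0 * x 0 1 1 + x 0 1 0 * x 1 0 1 * x 1 0 0 * x 0 1 1) +
    4 * (x 0 0 0 * x 0 1 1 * x 1 0 1 * x 1 1 0 + x 1 1 1 * x 1 0 0 * x 0 1 0 * x 0 0 1)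

/-- The restriction of `q` to the factor `A_{ijk}`, `{i, j, k} = ℓ`, is `c` times the
hyperdeterminant. -/
def RestrictsTo (q : MvPolynomial Idx ℂ) (ℓ : Fin 7) (c : ℂ) : Prop :=
  ∀ a : Cube → ℂ, MvPolynomial.eval (incl ℓ a) q = c * hyperdet a

end FanoE7

/-! The invariant form is explicit. A factor `A_{ijk}` has quadratic covariants with values in `S²
A_i`, `S² A_j` and `S² A_k`, and the hyperdeterminant is the discriminant of each of them. `quartic`
is the sum of the seven hyperdeterminants, of 21 polarized discriminants, which contract the
covariants of two lines in their common point, and of seven full contractions of the four tensors on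
the lines avoiding a point, with signs that make the sum invariant. A form annihilated by the vector
fields of the `E_i` and `F_i` is annihilated by all of `𝔢₇` (`rep_mem`), hence constant along
exponentials (`eval_exp_mulVec`). The fourteen annihilations are integer identities, checked in
`check_quartic`. The mixed terms vanish on every single factor (`eval_mixed`), so `quartic`
restricts to the hyperdeterminant.

Uniqueness comes from the weights. Invariance under `T` kills the coefficients of all monomials of
nonzero weight. The lifts `(1 + E_i)(1 - F_i)(1 + E_i)` of the simple reflections permute the
coordinates up to sign, so the coefficients of an `N(T)`-invariant form vanish simultaneously along
Weyl orbits. Every quartic monomial of weight zero can be moved to one of three monomials on the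
first line: `x₀₀₀² x₁₁₁²`, `x₀₀₀ x₁₁₁ x₁₀₀ x₀₁₁` and `x₀₀₀ x₀₁₁ x₁₀₁ x₁₁₀` (`quadruple_induction`).
A Weyl-invariant form that vanishes on the first factor has these three coefficients zero, so it is
zero; subtracting a multiple of `quartic` gives the Weyl characterization. Under the whole group,
the unipotents `1 + x` tie the last two coefficients to the first, which gives uniqueness of the
invariant form.

The action of `𝔰𝔩(A_i)` is found inside `𝔢₇` by writing its root vectors, up to sign, as iterated
brackets of simple root vectors. -/

namespace FanoE7

attribute [local instance 100] LieRing.ofAssociativeRing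

/-! ### Quartic forms as lists of terms -/

/-- A term `c x_a x_b x_d x_e`, the coordinates of `V` being numbered by `0, …, 55`. -/
abbrev Term : Type := ℤ × ℕ × ℕ × ℕ × ℕ

/-- The coordinate of `V` with a given number. -/
noncomputable def coord (a : ℕ) : MvPolynomial Idx ℂ :=
  MvPolynomial.X (code.symm (Fin.ofNat 56 a))

/-- The polynomial defined by a term. -/
noncomputable def Term.poly (t : Term) : MvPolynomial Idx ℂ :=
  MvPolynomial.C (t.1 : ℂ) * (coord t.2.1 * coord t.2.2.1 * coord t.2.2.2.1 * coord t.2.2.2.2)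

/-- The polynomial defined by a list of terms. -/
noncomputable def listPoly (L : List Term) : MvPolynomial Idx ℂ := (L.map Term.poly).sum

/-- The terms of the hyperdeterminant. -/
def hyperdetTerms : List Term :=
  [(1, 0, 0, 7, 7), (1, 1, 1, 6, 6), (1, 2, 2, 5, 5), (1, 4, 4, 3, 3),
   (-2, 0, 7, 1, 6), (-2, 0, 7, 2, 5), (-2, 0, 7, 4, 3), (-2, 1, 6, 2, 5), (-2, 1, 6, 4, 3),
   (-2, 2, 5, 4, 3), (4, 0, 3, 5, 6), (4, 7, 4, 2, 1)]

/-- The hyperdeterminant on the factor of a line. -/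
def lineTerms (l : ℕ) : List Term :=
  hyperdetTerms.map fun t =>
    (t.1, 8 * l + t.2.1, 8 * l + t.2.2.1, 8 * l + t.2.2.2.1, 8 * l + t.2.2.2.2)

/-- The coefficients `γ_{00}`, `γ_{01}`, `γ_{11}` of the quadratic covariant of the factor of the
line `l`, with values in `S² A_k`, where `k` is the point of `l` in position `p`. -/
def covariant (l p : ℕ) : List (List (ℤ × ℕ × ℕ)) :=
  let b := 8 * l
  -- `z` is the binary place value of the index in position `p`, and `x`, `y` are those of the other
  -- two positions.
  let z := 4 / 2 ^ p
  let x := if p = 0 then 2 else 4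
  let y := if p = 2 then 2 else 1
  [[(2, b, b + x + y), (-2, b + x, b + y)],
   [(1, b, b + x + y + z), (1, b + x + y, b + z), (-1, b + x, b + y + z), (-1, b + y, b + x + z)],
   [(2, b + z, b + z + x + y), (-2, b + z + x, b + z + y)]]

/-- The terms of `c f g` for quadratic forms `f` and `g`. -/
def mulTerms (c : ℤ) (f g : List (ℤ × ℕ × ℕ)) : List Term :=
  f.flatMap fun s => g.map fun t => (c * s.1 * t.1, s.2.1, s.2.2, t.2.1, t.2.2)

/-- The contraction of the quadratic covariants of two lines that meet in the point in position
`p` of the one, `p'` of the other. -/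
def pairTerms (l p l' p' : ℕ) : List Term :=
  match covariant l p, covariant l' p' with
  -- Polarization of the discriminant `b² - a d`, which for a single line is the hyperdeterminant.
  | [a, b, d], [a', b', d'] => mulTerms 2 b b' ++ mulTerms (-1) a d' ++ mulTerms (-1) d a'
  | _, _ => []

/-- The pairs of lines, with the positions of their common point. -/
def linePairs : List (ℕ × ℕ × ℕ × ℕ) :=
  [(0, 0, 1, 0), (0, 0, 2, 0), (0, 1, 3, 0), (0, 1, 4, 0), (0, 2, 5, 0), (0, 2, 6, 0),
   (1, 0, 2, 0), (1, 1, 3, 1), (1, 2, 4, 1), (1, 1, 5, 1), (1, 2, 6, 1),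
   (2, 1, 3, 2), (2, 2, 4, 2), (2, 2, 5, 2), (2, 1, 6, 2),
   (3, 0, 4, 0), (3, 1, 5, 1), (3, 2, 6, 2), (4, 2, 5, 2), (4, 1, 6, 1), (5, 0, 6, 0)]

/-- The line with number `l` contains `i`. -/
def onLine (l i : ℕ) : Bool := (List.finRange 3).any fun p => (line (Fin.ofNat 7 l) p).val == i

/-- The index in the factor of the line `l`, among the lines that avoid `q`, of the term numbered
`n` of `quadTerms q`. -/
def quadIdx (q n l : ℕ) : ℕ :=
  let bit (p : Fin 3) : ℕ :=
    let i := (line (Fin.ofNat 7 l) p).val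
    let e := n / 2 ^ i % 2
    -- A point `i ≠ q` lies on exactly two lines avoiding `q`. Bit `i` of `n` is the index on the
    -- first of them; the symplectic contraction puts the opposite index on the second.
    if (List.range l).any fun l' => onLine l' i && !onLine l' q then 1 - e else e
  8 * l + 4 * bit 0 + 2 * bit 1 + bit 2

/-- The contraction of the four tensors on the lines that avoid the point `q`. -/
def quadTerms (q : ℕ) : List Term :=
  ((List.range 128).filter fun n => n / 2 ^ q % 2 == 0).flatMap fun n =>
    -- Each contraction contributes the sign `(-1)^e`. The initial value is the overall sign of the
    -- contraction at `q`; it is opposite for `q = 3`.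
    let s := (List.range 7).foldl (fun s i => s + n / 2 ^ i % 2) (if q = 3 then 0 else 1)
    match (List.range 7).filter (fun l => !onLine l q) with
    | [a, b, c, d] =>
      [(if s % 2 = 0 then 4 else -4, quadIdx q n a, quadIdx q n b, quadIdx q n c, quadIdx q n d)]
    | _ => []

/-- The terms of the invariant quartic that lie on one line. -/
def diagTerms : List Term := (List.range 7).flatMap lineTerms

/-- The terms of the invariant quartic that lie on several lines. -/
def mixedTerms : List Term :=
  (linePairs.flatMap fun a => pairTerms a.1 a.2.1 a.2.2.1 a.2.2.2) ++
    (List.range 7).flatMap quadTerms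

/-- The terms of the invariant quartic. -/
def quarticTerms : List Term := diagTerms ++ mixedTerms

/-! ### Vanishing of a list of terms -/

/-- A search tree with keys that encode monomials, and coefficients. -/
inductive MonoTree : Type
  | leaf : MonoTree
  | node : MonoTree → ℕ → ℤ → MonoTree → MonoTree

/-- The key of a monomial. -/
def key (a b c d : ℕ) : ℕ := ((a % 56 * 56 + b % 56) * 56 + c % 56) * 56 + d % 56

/-- A function applied to two numbers in increasing order. -/
def inOrder (a b : ℕ) (k : ℕ → ℕ → ℕ) : ℕ := bif Nat.ble a b then k a b else k b a

/-- The key of a monomial, its factors being sorted. -/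
def sortedKey (a b c d : ℕ) : ℕ :=
  inOrder a b fun a b => inOrder c d fun c d => inOrder a c fun a c => inOrder b d fun b d =>
    inOrder b c fun b c => key a b c d

/-- Addition of a term to a tree. -/
def MonoTree.insert (k : ℕ) (c : ℤ) : MonoTree → MonoTree
  | leaf => node leaf k c leaf
  | node l k' c' r =>
    bif Nat.blt k k' then node (insert k c l) k' c' r
    else bif Nat.blt k' k then node l k' c' (insert k c r)
    else node l k' (c' + c) r

/-- All coefficients of a tree vanish. -/
def MonoTree.isZero : MonoTree → Bool
  | leaf => true
  | node l _ c r => isZero l && (c == 0 && isZero r)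

/-- The tree of a list of terms. -/
def toTree : List Term → MonoTree → MonoTree
  | [], T => T
  | t :: L, T => toTree L (T.insert (sortedKey t.2.1 t.2.2.1 t.2.2.2.1 t.2.2.2.2) t.1)

/-- The terms `k (v c) n`, for a factor of a term with coefficient `c` that a partial map sends to
`v` times the coordinate with number `n`. -/
def derivFactor (P : PMap) (c : ℤ) (a : ℕ) (k : ℤ → ℕ → Term) : List Term :=
  match P (Fin.ofNat 56 a) with
  | none => []
  | some (n, v) => [k (v * c) n.val]

/-- The image of a term under the derivation that is given on the coordinates by a partial map. -/
def derivTerm (P : PMap) (t : Term) : List Term :=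
  match t with
  | (e, a, b, c, d) =>
    derivFactor P e a (fun v a => (v, a, b, c, d)) ++
      (derivFactor P e b (fun v b => (v, a, b, c, d)) ++
      (derivFactor P e c (fun v c => (v, a, b, c, d)) ++
        derivFactor P e d (fun v d => (v, a, b, c, d))))

/-! ### Soundness of the computation with lists and trees -/

open MvPolynomial

theorem coord_mod (a : ℕ) : coord (a % 56) = coord a := by
  unfold coord
  congr 2
  ext
  simp

/-- The monomial with a given key. -/
noncomputable def keyMono (k : ℕ) : MvPolynomial Idx ℂ :=
  coord (k / 56 / 56 / 56) * coord (k / 56 / 56) * coord (k / 56) * coord k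

/-- The key is a number with four base-56 digits. Since `coord` depends only on the residue modulo
56, `keyMono` need not strip the higher digits. -/
theorem keyMono_key (a b c d : ℕ) :
    keyMono (key a b c d) = coord a * coord b * coord c * coord d := by
  have ha := Nat.mod_lt a (show 0 < 56 by norm_num)
  have hb := Nat.mod_lt b (show 0 < 56 by norm_num)
  have hc := Nat.mod_lt c (show 0 < 56 by norm_num)
  have hd := Nat.mod_lt d (show 0 < 56 by norm_num)
  rw [← coord_mod a, ← coord_mod b, ← coord_mod c, ← coord_mod d]
  unfold keyMono key
  generalize a % 56 = a at *
  generalize b % 56 = b at *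
  generalize c % 56 = c at *
  generalize d % 56 = d at *
  have h1 : (((a * 56 + b) * 56 + c) * 56 + d) / 56 = (a * 56 + b) * 56 + c := by omega
  have h2 : ((a * 56 + b) * 56 + c) / 56 = a * 56 + b := by omega
  have h3 : (a * 56 + b) / 56 = a := by omega
  rw [h1, h2, h3, ← coord_mod (a * 56 + b), ← coord_mod (_ + c), ← coord_mod (_ + d),
    Nat.mul_add_mod_self_right, Nat.mul_add_mod_self_right, Nat.mul_add_mod_self_right,
    Nat.mod_eq_of_lt hb, Nat.mod_eq_of_lt hc, Nat.mod_eq_of_lt hd]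

theorem keyMono_inOrder (a b : ℕ) (k : ℕ → ℕ → ℕ) (p : MvPolynomial Idx ℂ)
    (h : keyMono (k a b) = p) (h' : keyMono (k b a) = p) : keyMono (inOrder a b k) = p := by
  unfold inOrder
  cases Nat.ble a b
  · exact h'
  · exact h

/-- Each of the 32 outcomes of the five comparisons permutes the factors, so the product is
unchanged. That the outcome is sorted is not needed for soundness; it only lets equal monomials meet
in the tree. -/
theorem keyMono_sortedKey (a b c d : ℕ) :
    keyMono (sortedKey a b c d) = coord a * coord b * coord c * coord d := by
  unfold sortedKey
  iterate 5 all_goals refine keyMono_inOrder _ _ _ _ ?_ ?_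
  all_goals exact (keyMono_key _ _ _ _).trans (by ring)

/-- The polynomial defined by a tree. -/
noncomputable def MonoTree.poly : MonoTree → MvPolynomial Idx ℂ
  | leaf => 0
  | node l k c r => poly l + C (c : ℂ) * keyMono k + poly r

/-- No ordering of the tree is assumed: wherever the term is placed, the sum grows by it. -/
theorem MonoTree.poly_insert (k : ℕ) (c : ℤ) (T : MonoTree) :
    (T.insert k c).poly = T.poly + C (c : ℂ) * keyMono k := by
  induction T with
  | leaf => simp [insert, poly]
  | node l k' c' r hl hr =>
    rw [insert]
    rcases h : Nat.blt k k'
    · rcases h' : Nat.blt k' k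
      · have e : k = k' := by
          have h1 : ¬ k < k' := fun e => Bool.false_ne_true (h.symm.trans (Nat.blt_eq.symm ▸ e))
          have h2 : ¬ k' < k := fun e => Bool.false_ne_true (h'.symm.trans (Nat.blt_eq.symm ▸ e))
          omega
        subst e
        simp only [cond_false, poly, Int.cast_add, map_add]
        ring
      · simp only [cond_false, cond_true, poly, hr]
        ring
    · simp only [cond_true, poly, hl]
      ring

theorem MonoTree.poly_eq_zero (T : MonoTree) (h : T.isZero = true) : T.poly = 0 := by
  induction T with
  | leaf => rfl
  | node l k c r hl hr =>
    simp only [isZero, Bool.and_eq_true, beq_iff_eq] at h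
    simp [poly, hl h.1, hr h.2.2, h.2.1]

theorem poly_toTree (L : List Term) (T : MonoTree) :
    (toTree L T).poly = T.poly + listPoly L := by
  induction L generalizing T with
  | nil => simp [toTree, listPoly]
  | cons t L ih =>
    rw [toTree, ih, MonoTree.poly_insert, keyMono_sortedKey]
    simp only [listPoly, List.map_cons, List.sum_cons, Term.poly]
    ring

theorem listPoly_eq_zero (L : List Term) (h : (toTree L .leaf).isZero = true) :
    listPoly L = 0 := by
  have := poly_toTree L .leaf
  rw [MonoTree.poly_eq_zero _ h] at this
  simpa [MonoTree.poly] using this.symm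

theorem listPoly_append (L L' : List Term) :
    listPoly (L ++ L') = listPoly L + listPoly L' := by
  simp [listPoly]

/-- The Leibniz rule, one summand for each of the four factors; repeated factors are treated
separately. -/
theorem derivation_term (D : Derivation ℂ (MvPolynomial Idx ℂ) (MvPolynomial Idx ℂ)) (P : PMap)
    (h : ∀ n, D (X (code.symm n)) = match P n with
      | none => 0
      | some (k, v) => C (v : ℂ) * X (code.symm k)) (t : Term) :
    D t.poly = listPoly (derivTerm P t) := by
  have hc (a : ℕ) : D (coord a) = match P (Fin.ofNat 56 a) with
      | none => 0
      | some (k, v) => C (v : ℂ) * coord k.val := by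
    rw [coord, h]
    rcases P (Fin.ofNat 56 a) with _ | ⟨k, v⟩
    · rfl
    · simp [coord]
  obtain ⟨e, a, b, c, d⟩ := t
  have hf (a : ℕ) (k : ℤ → ℕ → Term) (p : MvPolynomial Idx ℂ)
      (hk : ∀ v n, (k (v * e) n).poly = C (v : ℂ) * coord n * p) :
      D (coord a) * p = listPoly (derivFactor P e a k) := by
    rw [hc, derivFactor]
    rcases P (Fin.ofNat 56 a) with _ | ⟨n, v⟩
    · simp [listPoly]
    · simp [listPoly, hk]
  unfold derivTerm
  simp only [listPoly_append]
  rw [← hf a (fun v a => (v, a, b, c, d)) (C (e : ℂ) * (coord b * coord c * coord d)),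
    ← hf b (fun v b => (v, a, b, c, d)) (C (e : ℂ) * (coord a * coord c * coord d)),
    ← hf c (fun v c => (v, a, b, c, d)) (C (e : ℂ) * (coord a * coord b * coord d)),
    ← hf d (fun v d => (v, a, b, c, d)) (C (e : ℂ) * (coord a * coord b * coord c))]
  · simp only [Term.poly, Derivation.leibniz, smul_eq_mul]
    rw [show D (C (e : ℂ)) = 0 from D.map_algebraMap (e : ℂ)]
    ring
  all_goals
    intro v n
    simp only [Term.poly, Int.cast_mul, map_mul]
    ring

theorem derivation_listPoly (D : Derivation ℂ (MvPolynomial Idx ℂ) (MvPolynomial Idx ℂ))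
    (P : PMap)
    (h : ∀ n, D (X (code.symm n)) = match P n with
      | none => 0
      | some (k, v) => C (v : ℂ) * X (code.symm k)) (L : List Term) :
    D (listPoly L) = listPoly (L.flatMap (derivTerm P)) := by
  induction L with
  | nil => simp [listPoly]
  | cons t L ih =>
    rw [List.flatMap_cons, listPoly_append, ← ih, ← derivation_term D P h]
    simp [listPoly]

/-! ### Linear vector fields -/

/-- The derivation of the polynomial functions on `V` along the linear vector field of a matrix. -/
noncomputable def vectorField (A : Matrix Idx Idx ℂ) :
    Derivation ℂ (MvPolynomial Idx ℂ) (MvPolynomial Idx ℂ) :=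
  mkDerivation ℂ fun m => ∑ n, C (A m n) * X n

theorem vectorField_X (A : Matrix Idx Idx ℂ) (m : Idx) :
    vectorField A (X m) = ∑ n, C (A m n) * X n :=
  mkDerivation_X ℂ _ m

theorem vectorField_C_mul (A : Matrix Idx Idx ℂ) (c : ℂ) (p : MvPolynomial Idx ℂ) :
    vectorField A (C c * p) = C c * vectorField A p := by
  rw [← smul_eq_C_mul, ← smul_eq_C_mul, Derivation.map_smul]

theorem vectorField_vectorField_X (A B : Matrix Idx Idx ℂ) (m : Idx) :
    vectorField A (vectorField B (X m)) = vectorField (B * A) (X m) := by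
  simp only [vectorField_X, map_sum, vectorField_C_mul, Matrix.mul_apply, Finset.mul_sum,
    Finset.sum_mul, map_mul]
  rw [Finset.sum_comm]
  simp only [mul_assoc]

theorem vectorField_add (A B : Matrix Idx Idx ℂ) :
    vectorField (A + B) = vectorField A + vectorField B := by
  apply derivation_ext
  intro m
  simp [vectorField_X, add_mul, Finset.sum_add_distrib]

theorem vectorField_smul (c : ℂ) (A : Matrix Idx Idx ℂ) :
    vectorField (c • A) = c • vectorField A := by
  apply derivation_ext
  intro m
  simp [vectorField_X, Finset.smul_sum, smul_eq_C_mul, mul_assoc]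

/-- Operators on functions compose in the order opposite to matrices. The composites themselves are
not derivations, so only their values on coordinates are compared; these determine the two
commutators. -/
theorem vectorField_lie (A B : Matrix Idx Idx ℂ) :
    vectorField ⁅A, B⁆ = ⁅vectorField B, vectorField A⁆ := by
  apply derivation_ext
  intro m
  rw [Derivation.commutator_apply, vectorField_vectorField_X, vectorField_vectorField_X,
    Ring.lie_def, sub_eq_add_neg, ← neg_one_smul ℂ (B * A), vectorField_add, vectorField_smul]
  simp [sub_eq_add_neg]

/-- The matrices whose linear vector fields annihilate a polynomial. -/
noncomputable def annihilator (q : MvPolynomial Idx ℂ) : LieSubalgebra ℂ (Matrix Idx Idx ℂ) where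
  carrier := {A | vectorField A q = 0}
  add_mem' {A B} hA hB := by
    simp only [Set.mem_ofPred_eq] at *
    rw [vectorField_add, Derivation.add_apply, hA, hB, add_zero]
  zero_mem' := by
    simp only [Set.mem_ofPred_eq]
    rw [← zero_smul ℂ (0 : Matrix Idx Idx ℂ), vectorField_smul]
    simp
  smul_mem' c A hA := by
    simp only [Set.mem_ofPred_eq] at *
    rw [vectorField_smul, Derivation.smul_apply, hA, smul_zero]
  lie_mem' {A B} hA hB := by
    change vectorField A q = 0 at hA
    change vectorField B q = 0 at hB
    change vectorField ⁅A, B⁆ q = 0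
    rw [vectorField_lie, Derivation.commutator_apply, hA, hB, map_zero, map_zero, sub_self]

theorem rep_mk (y : FreeLieAlgebra ℂ (CartanMatrix.Generators (Fin 7))) :
    rep (LieSubmodule.Quotient.mk y) = freeRep y := rfl

/-- A Lie algebra of matrices that contains the generators contains the image of `𝔢₇`. -/
theorem rep_mem (S : LieSubalgebra ℂ (Matrix Idx Idx ℂ)) (h : ∀ g, gen g ∈ S)
    (x : LieAlgebra.e₇ ℂ) : rep x ∈ S := by
  induction x using Submodule.Quotient.induction_on with | _ y
  change freeRep y ∈ S
  have : freeRep = S.incl.comp (FreeLieAlgebra.lift ℂ fun g => (⟨gen g, h g⟩ : S)) := by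
    ext g
    simp [freeRep]
  rw [this]
  exact Subtype.property _

/-- A polynomial that is annihilated by the vector field of `A` is invariant under `exp A`. -/
theorem eval_exp_mulVec (A : Matrix Idx Idx ℂ) (q : MvPolynomial Idx ℂ) (h : vectorField A q = 0)
    (v : V) : eval ((NormedSpace.exp A).mulVec v) q = eval v q := by
  open scoped Matrix.Norms.Operator in
  let y (t : ℂ) : V := (NormedSpace.exp (t • A)).mulVec v
  have hy (t : ℂ) (m : Idx) : HasDerivAt (fun t => y t m) (A.mulVec (y t) m) t := by
    have h1 := hasDerivAt_exp_smul_const' (𝕂 := ℂ) A t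
    have h2 (n : Idx) : HasDerivAt (fun t : ℂ => NormedSpace.exp (t • A) m n)
        ((A * NormedSpace.exp (t • A)) m n) t := by
      have := (LinearMap.toContinuousLinearMap
        (Matrix.entryLinearMap ℂ ℂ m n)).hasFDerivAt.comp_hasDerivAt t h1
      exact this
    have h3 : HasDerivAt (fun t : ℂ => ∑ n, NormedSpace.exp (t • A) m n * v n)
        (∑ n, (A * NormedSpace.exp (t • A)) m n * v n) t :=
      HasDerivAt.fun_sum fun n _ => (h2 n).mul_const _
    have h4 : A.mulVec (y t) m = ∑ n, (A * NormedSpace.exp (t • A)) m n * v n := by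
      change A.mulVec ((NormedSpace.exp (t • A)).mulVec v) m = _
      rw [Matrix.mulVec_mulVec]
      rfl
    rw [h4]
    exact h3
  -- Chain rule along the curve `y`, which solves `y' = A y`: the derivative of `p` is the value of
  -- its vector field derivative. For `q` this is zero, so `q` has equal values at times `1` and
  -- `0`.
  have hp (p : MvPolynomial Idx ℂ) (t : ℂ) :
      HasDerivAt (fun t => eval (y t) p) (eval (y t) (vectorField A p)) t := by
    induction p using MvPolynomial.induction_on with
    | C a =>
      rw [show vectorField A (C a) = 0 from (vectorField A).map_algebraMap a]
      simpa using hasDerivAt_const t a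
    | add p p' hp hp' =>
      simp only [map_add]
      exact hp.fun_add hp'
    | mul_X p m hp =>
      simp only [map_mul, eval_X]
      refine (hp.fun_mul (hy t m)).congr_deriv ?_
      rw [Derivation.leibniz, vectorField_X]
      simp only [smul_eq_mul, map_add, map_mul, eval_X, map_sum, eval_C, Matrix.mulVec,
        dotProduct]
      ring
  have hd : Differentiable ℂ fun t => eval (y t) q := fun t => (hp q t).differentiableAt
  have := is_const_of_deriv_eq_zero hd (fun t => by rw [(hp q t).deriv, h, map_zero]) 1 0
  simpa [y] using this

theorem isInvariant_closure (S : Set (GL Idx ℂ)) (q : MvPolynomial Idx ℂ)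
    (h : ∀ g ∈ S, ∀ v : V, eval ((g : Matrix Idx Idx ℂ).mulVec v) q = eval v q) :
    IsInvariant (Subgroup.closure S) q := by
  intro g hg
  induction hg using Subgroup.closure_induction with
  | mem g hg => exact h g hg
  | one => simp
  | mul a b _ _ ha hb =>
    intro v
    rw [Units.val_mul, ← Matrix.mulVec_mulVec, ha, hb]
  | inv a _ ha =>
    intro v
    rw [← ha, Matrix.mulVec_mulVec, ← Units.val_mul, mul_inv_cancel]
    simp

/-- The annihilator of `q` is a Lie subalgebra, and `H_i = ⁅E_i, F_i⁆`, so the root vectors suffice.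
-/
theorem isE7Invariant_of_gen (q : MvPolynomial Idx ℂ)
    (hE : ∀ i, vectorField (gen (.E i)) q = 0) (hF : ∀ i, vectorField (gen (.F i)) q = 0) :
    IsE7Invariant q := by
  apply isInvariant_closure
  rintro g ⟨x, hg⟩ v
  rw [hg]
  apply eval_exp_mulVec
  change rep x ∈ annihilator q
  apply rep_mem
  have hE (i) : gen (.E i) ∈ annihilator q := hE i
  have hF (i) : gen (.F i) ∈ annihilator q := hF i
  rintro (i | i | i)
  · have : gen (.H i) = ⁅gen (.E i), gen (.F i)⁆ := gen_lie _ _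
    rw [this]
    exact (annihilator q).lie_mem (hE i) (hF i)
  · exact hE i
  · exact hF i

/-- The invariant quartic form. -/
noncomputable def quartic : MvPolynomial Idx ℂ := listPoly quarticTerms

/-! ### Invariance of the quartic form -/

theorem check_transpose : ∀ b i n, ∀ a ∈ chevP b i n, chevP (!b) i a.1 = some (n, a.2) := by
  decide +kernel

/-- The operators of opposite simple root vectors are transposes of each other. -/
theorem chevP_transpose (b : Bool) (i : Fin 7) (m n : Fin 56) (c : ℤ) :
    chevP b i n = some (m, c) ↔ chevP (!b) i m = some (n, c) := by
  constructor
  · intro h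
    exact check_transpose b i n (m, c) (by simp [h])
  · intro h
    have := check_transpose (!b) i m (n, c) (by simp [h])
    rwa [Bool.not_not] at this

/-- A partial map lists the columns of its matrix, whereas a vector field acts on coordinates
through the rows. Transposition turns the rows for `b` into the columns for `!b`. -/
theorem toM_apply_eq (b : Bool) (i : Fin 7) (m n : Fin 56) :
    toM (chevP b i) m n = toM (chevP (!b) i) n m := by
  have h (b : Bool) (m n : Fin 56) (c : ℤ) (hc : c ≠ 0) :
      toM (chevP b i) m n = c ↔ chevP b i n = some (m, c) := by
    rw [toM]
    rcases chevP b i n with _ | ⟨k, d⟩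
    · simp [hc.symm]
    · by_cases e : m = k
      · simp [e]
      · simp [e, hc.symm, Ne.symm e]
  by_cases hc : toM (chevP (!b) i) n m = 0
  · by_contra h'
    rw [hc] at h'
    have := (h b m n _ h').1 rfl
    rw [chevP_transpose, ← h _ _ _ _ h', hc] at this
    exact h' this.symm
  · rw [h b m n _ hc, chevP_transpose, ← h _ _ _ _ hc]

/-- The operators of the simple root vectors (`b = true`) and of their opposites. -/
noncomputable def simpleOp (b : Bool) (i : Fin 7) : Matrix Idx Idx ℂ :=
  (Int.castRingHom ℂ).mapMatrix (chev (sg b) i)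

theorem simpleOp_apply (b : Bool) (i : Fin 7) (m n : Idx) :
    simpleOp b i m n = (toM (chevP b i) (code m) (code n) : ℂ) := by
  rw [simpleOp, chev_eq]
  rfl

theorem vectorField_chev (b : Bool) (i : Fin 7) (n : Fin 56) :
    vectorField (simpleOp b i) (X (code.symm n)) = match chevP (!b) i n with
      | none => 0
      | some (k, v) => C (v : ℂ) * X (code.symm k) := by
  rw [vectorField_X]
  simp only [simpleOp_apply, Equiv.apply_symm_apply, toM_apply_eq b]
  rw [← code.symm.sum_comp]
  simp only [Equiv.apply_symm_apply, toM]
  rcases chevP (!b) i n with _ | ⟨k, v⟩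
  · simp
  · simp [apply_ite (C : ℂ → MvPolynomial Idx ℂ), ite_mul]

-- The infinitesimal invariance of `quartic` under the fourteen operators: all image terms are
-- collected by monomial, and every total is zero.
set_option maxRecDepth 100000 in
theorem check_quartic : ∀ b i,
    (toTree (quarticTerms.flatMap (derivTerm (chevP (!b) i))) .leaf).isZero = true := by
  decide +kernel

theorem vectorField_quartic (b : Bool) (i : Fin 7) : vectorField (simpleOp b i) quartic = 0 := by
  rw [quartic, derivation_listPoly _ _ (vectorField_chev b i)]
  exact listPoly_eq_zero _ (check_quartic b i)

theorem quartic_invariant : IsE7Invariant quartic :=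
  isE7Invariant_of_gen _ (vectorField_quartic true) (vectorField_quartic false)

theorem listPoly_isHomogeneous (L : List Term) : (listPoly L).IsHomogeneous 4 := by
  induction L with
  | nil => exact isHomogeneous_zero _ _ _
  | cons t L ih =>
    have hX (a : ℕ) : (coord a).IsHomogeneous 1 := isHomogeneous_X _ _
    have : t.poly.IsHomogeneous (0 + (1 + 1 + 1 + 1)) :=
      (isHomogeneous_C _ _).mul ((((hX _).mul (hX _)).mul (hX _)).mul (hX _))
    simpa [listPoly] using this.add ih

/-! ### Restriction to the factors -/

theorem eval_listPoly (v : V) (L : List Term) : eval v (listPoly L) =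
    (L.map fun t => (t.1 : ℂ) * (eval v (coord t.2.1) * eval v (coord t.2.2.1) *
      eval v (coord t.2.2.2.1) * eval v (coord t.2.2.2.2))).sum := by
  induction L with
  | nil => simp [listPoly]
  | cons t L ih =>
    rw [listPoly] at ih
    simp [listPoly, Term.poly, ih]

theorem eval_incl_coord (l : Fin 7) (a : Cube → ℂ) (n : ℕ) :
    eval (incl l a) (coord n) =
      if (code.symm (Fin.ofNat 56 n)).1 = l then a (code.symm (Fin.ofNat 56 n)).2 else 0 := by
  rw [coord, eval_X]
  rfl

-- The quotient by 8 is the number of the line. Comparing the first and last factor is enough: in a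
-- pair term they belong to the two covariants, in a quadruple term to different lines.
set_option maxRecDepth 100000 in
theorem check_mixed : ∀ t ∈ mixedTerms, t.2.1 % 56 / 8 ≠ t.2.2.2.2 % 56 / 8 := by
  decide +kernel

theorem code_symm_fst (n : ℕ) : ((code.symm (Fin.ofNat 56 n)).1 : ℕ) = n % 56 / 8 := by
  change n % 56 / 8 % 7 = n % 56 / 8
  omega

theorem eval_mixed (l : Fin 7) (a : Cube → ℂ) : eval (incl l a) (listPoly mixedTerms) = 0 := by
  rw [eval_listPoly]
  apply List.sum_eq_zero
  intro x hx
  obtain ⟨t, ht, rfl⟩ := List.mem_map.1 hx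
  have := check_mixed t ht
  rw [eval_incl_coord l a t.2.1, eval_incl_coord l a t.2.2.2.2]
  by_cases h : (code.symm (Fin.ofNat 56 t.2.1)).1 = l
  · rw [if_neg (c := (code.symm (Fin.ofNat 56 t.2.2.2.2)).1 = l)]
    · simp
    · intro h'
      apply this
      rw [← code_symm_fst, ← code_symm_fst, h, h']
  · rw [if_neg h]
    simp

theorem eval_lineTerms (l k : Fin 7) (a : Cube → ℂ) :
    eval (incl l a) (listPoly (lineTerms k)) = if k = l then hyperdet a else 0 := by
  have h (n : Fin 8) : eval (incl l a) (coord (8 * k.val + n.val)) =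
      if k = l then a ![Fin.ofNat 2 (n.val / 4), Fin.ofNat 2 (n.val / 2), Fin.ofNat 2 n.val]
      else 0 := by
    have h1 : code.symm (Fin.ofNat 56 (8 * k.val + n.val)) =
        (k, ![Fin.ofNat 2 (n.val / 4), Fin.ofNat 2 (n.val / 2), Fin.ofNat 2 n.val]) := by
      revert k n
      decide +kernel
    rw [eval_incl_coord, h1]
  have h0 := h 0
  have h1 := h 1
  have h2 := h 2
  have h3 := h 3
  have h4 := h 4
  have h5 := h 5
  have h6 := h 6
  have h7 := h 7
  rw [eval_listPoly, lineTerms, hyperdetTerms]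
  simp at h0 h1 h2 h3 h4 h5 h6 h7
  simp [h0, h1, h2, h3, h4, h5, h6, h7]
  split
  · simp [hyperdet]
    ring
  · simp

theorem quartic_restrictsTo (l : Fin 7) : RestrictsTo quartic l 1 := by
  intro a
  have h (L : List ℕ) : eval (incl l a) (listPoly (L.flatMap lineTerms)) =
      (L.map fun k => eval (incl l a) (listPoly (lineTerms k))).sum := by
    induction L with
    | nil => simp [listPoly]
    | cons k L ih => simp [List.flatMap_cons, listPoly_append, ih]
  rw [quartic, quarticTerms, listPoly_append, map_add, eval_mixed, add_zero, diagTerms, h,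
    ← List.map_coe_finRange_eq_range, List.map_map]
  simp only [Function.comp_def, eval_lineTerms]
  rw [← Fin.sum_univ_def]
  simp

theorem quartic_ne_zero : quartic ≠ 0 := by
  intro h
  -- At `e₀₀₀ + e₁₁₁` the hyperdeterminant is `1`.
  have := quartic_restrictsTo 0 fun s => if s = ![0, 0, 0] ∨ s = ![1, 1, 1] then 1 else 0
  simp [h, hyperdet] at this

/-! ### Elements of the torus and of its normalizer -/

theorem exp_of_mul_self_eq_zero (A : Matrix Idx Idx ℂ) (h : A * A = 0) :
    NormedSpace.exp A = 1 + A := by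
  open scoped Matrix.Norms.Operator in
  rw [NormedSpace.exp_eq_tsum ℂ]
  simp only
  rw [tsum_eq_sum (s := Finset.range 2)]
  · simp [Finset.sum_range_succ]
  · intro n hn
    obtain ⟨k, rfl⟩ := Nat.exists_eq_add_of_le (not_lt.1 fun h => hn (Finset.mem_range.2 h))
    rw [pow_add, pow_two, h, zero_mul, smul_zero]

/-- The Chevalley generators of `𝔢₇`. -/
noncomputable def genVec (g : CartanMatrix.Generators (Fin 7)) : LieAlgebra.e₇ ℂ :=
  LieSubmodule.Quotient.mk (FreeLieAlgebra.of ℂ g)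

theorem rep_genVec (g : CartanMatrix.Generators (Fin 7)) : rep (genVec g) = gen g :=
  (rep_mk _).trans (freeRep_of g)

/-- The simple root vector `E_i` (`b = true`) or its opposite `F_i`, as an element of `𝔢₇`. -/
noncomputable def simpleVec (b : Bool) (i : Fin 7) : LieAlgebra.e₇ ℂ :=
  genVec (if b then .E i else .F i)

theorem rep_simpleVec (b : Bool) (i : Fin 7) : rep (simpleVec b i) = simpleOp b i := by
  rw [simpleVec, rep_genVec]
  cases b <;> rfl

theorem simpleOp_eq (b : Bool) (i : Fin 7) : simpleOp b i =
    ((Int.castRingHom ℂ).mapMatrix (toM (chevP b i))).submatrix code code := by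
  rw [simpleOp, chev_eq]
  rfl

/-- The representation is minuscule: no weight can be shifted twice by the same root. -/
theorem chev_mul_self (b : Bool) (i : Fin 7) : chev (sg b) i * chev (sg b) i = 0 := by
  rw [chev_eq, sub_mul_sub, toM_mul, toM_none, Matrix.submatrix_zero]
  · rfl
  · intro n
    cases b
    · exact (check_sq i n).2
    · exact (check_sq i n).1

theorem simpleOp_mul_self (b : Bool) (i : Fin 7) : simpleOp b i * simpleOp b i = 0 := by
  rw [simpleOp, ← map_mul, chev_mul_self, map_zero]

theorem mem_groupE7 (g : GL Idx ℂ) (x : LieAlgebra.e₇ ℂ)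
    (h : (g : Matrix Idx Idx ℂ) = NormedSpace.exp (rep x)) : g ∈ groupE7 :=
  Subgroup.subset_closure ⟨x, h⟩

/-- The element `1 + c x` of the group `E₇`, for a simple root vector `x` or its opposite. -/
theorem exists_unipotent (b : Bool) (i : Fin 7) (c : ℂ) :
    ∃ g ∈ groupE7, (g : Matrix Idx Idx ℂ) = 1 + c • simpleOp b i := by
  have h : NormedSpace.exp (rep (c • simpleVec b i)) = 1 + c • simpleOp b i := by
    rw [map_smul, rep_simpleVec, exp_of_mul_self_eq_zero]
    rw [smul_mul_smul_comm, simpleOp_mul_self, smul_zero]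
  obtain ⟨g, hg⟩ := Matrix.isUnit_exp (rep (c • simpleVec b i))
  exact ⟨g, mem_groupE7 g _ hg, hg.trans h⟩

/-- The permutation of the weights given by a simple reflection. -/
def refl (i : Fin 7) (n : Fin 56) : Fin 56 :=
  match chevP true i n with
  | some a => a.1
  | none =>
    match chevP false i n with
    | some a => a.1
    | none => n

/-- The coefficients of a lift of a simple reflection to the normalizer of the torus. -/
def reflSign (i : Fin 7) (n : Fin 56) : ℤ :=
  match chevP true i n with
  | some a => a.2
  | none =>
    match chevP false i n with
    | some a => -a.2
    | none => 1

theorem check_refl : ∀ i n, refl i (refl i n) = n ∧ (reflSign i n = 1 ∨ reflSign i n = -1) := by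
  decide +kernel

theorem refl_refl (i : Fin 7) (n : Fin 56) : refl i (refl i n) = n := (check_refl i n).1

theorem reflSign_ne_zero (i : Fin 7) (n : Fin 56) : reflSign i n ≠ 0 := by
  rcases (check_refl i n).2 with h | h <;> rw [h] <;> decide

theorem check_efe : ∀ i n, comp (comp (chevP true i) (chevP false i)) (chevP true i) n =
    chevP true i n := by
  decide +kernel

/-- `EF + FE` is the projection onto the weight vectors that the simple reflection moves. -/
theorem check_ef_add_fe : ∀ i n, (chevP true i n = none ∨ chevP false i n = none) ∧
    coef (comp (chevP true i) (chevP false i)) n + coef (comp (chevP false i) (chevP true i)) n =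
      if chevP true i n = none ∧ chevP false i n = none then 0 else 1 := by
  decide +kernel

/-- The lift of a simple reflection to the normalizer of the torus, over the integers. -/
def reflP (i : Fin 7) : PMap := fun n => some (refl i n, reflSign i n)

/-- With `E² = 0` and `EFE = E`, the product `exp(E) exp(-F) exp(E)` collapses to `1 - (EF + FE) + E
- F`. This is the identity on the fixed weights and a signed transposition on each pair of weights
that is exchanged. -/
theorem toM_reflP (i : Fin 7) :
    (1 + toM (chevP true i)) * (1 - toM (chevP false i)) * (1 + toM (chevP true i)) =
      toM (reflP i) := by
  have hsq : toM (chevP true i) * toM (chevP true i) = 0 := by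
    rw [toM_mul, toM_none]
    exact fun n => (check_sq i n).1
  have hefe : toM (chevP true i) * toM (chevP false i) * toM (chevP true i) =
      toM (chevP true i) := by
    rw [toM_mul, toM_mul]
    congr 1
    funext n
    exact check_efe i n
  have hef : toM (chevP true i) * toM (chevP false i) = _ :=
    (toM_mul _ _).trans (toM_diag _ fun n => (check_diag i n).1)
  have hfe : toM (chevP false i) * toM (chevP true i) = _ :=
    (toM_mul _ _).trans (toM_diag _ fun n => (check_diag i n).2)
  have h1 : (1 + toM (chevP true i)) * (1 - toM (chevP false i)) * (1 + toM (chevP true i)) =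
      1 + toM (chevP true i) - toM (chevP false i) - (toM (chevP true i) * toM (chevP false i) +
        toM (chevP false i) * toM (chevP true i)) + (toM (chevP true i) -
        toM (chevP true i) * toM (chevP false i) * toM (chevP true i)) +
        toM (chevP true i) * toM (chevP true i) := by
    noncomm_ring
  rw [h1, hsq, hefe, hef, hfe, Matrix.diagonal_add, sub_self, add_zero, add_zero,
    ← Matrix.diagonal_one]
  ext m n
  obtain ⟨h2, h3⟩ := check_ef_add_fe i n
  simp only [Matrix.sub_apply, Matrix.add_apply, Matrix.diagonal_apply, toM, reflP, refl, reflSign]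
  have h4 : (if m = n then coef (comp (chevP true i) (chevP false i)) m +
      coef (comp (chevP false i) (chevP true i)) m else 0) = if m = n then
        (if chevP true i n = none ∧ chevP false i n = none then 0 else 1) else 0 := by
    split
    · rename_i e
      rw [e, h3]
    · rfl
  rw [h4]
  rcases he : chevP true i n with _ | ⟨k, v⟩ <;> rcases hf : chevP false i n with _ | ⟨k', v'⟩
  · simp
  · simp only [reduceCtorEq, and_false, if_false]
    split_ifs <;> ring
  · simp
  · simp [he, hf] at h2

/-- The lift of a simple reflection to the normalizer of the torus. -/
noncomputable def reflMat (i : Fin 7) : Matrix Idx Idx ℂ :=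
  ((Int.castRingHom ℂ).mapMatrix (toM (reflP i))).submatrix code code

theorem reflMat_eq (i : Fin 7) : reflMat i =
    (1 + (1 : ℂ) • simpleOp true i) * (1 + (-1 : ℂ) • simpleOp false i) *
      (1 + (1 : ℂ) • simpleOp true i) := by
  have h (A B : Matrix (Fin 56) (Fin 56) ℂ) :
      A.submatrix code code * B.submatrix code code = (A * B).submatrix code code :=
    Matrix.submatrix_mul_equiv A B code code code
  rw [reflMat, ← toM_reflP]
  simp only [map_mul, map_add, map_sub, map_one, ← h, simpleOp_eq, one_smul, neg_one_smul,
    ← sub_eq_add_neg, Matrix.submatrix_add, Matrix.submatrix_sub, Pi.add_apply, Pi.sub_apply]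
  simp

theorem reflMat_mulVec (i : Fin 7) (v : V) (m : Idx) :
    (reflMat i).mulVec v m = (reflSign i (refl i (code m)) : ℂ) * v (code.symm (refl i (code m))) := by
  rw [Matrix.mulVec, dotProduct, ← code.symm.sum_comp]
  have h (n : Fin 56) : reflMat i m (code.symm n) * v (code.symm n) =
      if n = refl i (code m) then
        (reflSign i (refl i (code m)) : ℂ) * v (code.symm (refl i (code m))) else 0 := by
    have h1 : reflMat i m (code.symm n) =
        ((if code m = refl i n then reflSign i n else 0 : ℤ) : ℂ) := by
      simp [reflMat, toM, reflP]
    rw [h1]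
    by_cases e : n = refl i (code m)
    · subst e
      rw [refl_refl, if_pos rfl, if_pos rfl]
    · rw [if_neg e, if_neg]
      · simp
      · intro e'
        rw [e', refl_refl] at e
        exact e rfl
  simp only [h, Finset.sum_ite_eq', Finset.mem_univ, if_true]

/-- The weight of the torus element with coordinates `c` on a weight vector. -/
noncomputable def torusWeight (c : Fin 7 → ℂ) (m : Idx) : ℂ := ∑ i, c i * (corootP i (code m) : ℂ)

theorem sum_smul_gen (c : Fin 7 → ℂ) :
    ∑ i, c i • gen (.H i) = Matrix.diagonal (torusWeight c) := by
  have h (i : Fin 7) : gen (.H i) = Matrix.diagonal fun m => (corootP i (code m) : ℂ) := by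
    rw [gen, genZ, coroot_eq]
    ext m n
    by_cases e : m = n <;> simp [e]
  ext m n
  simp only [h, Matrix.sum_apply, Matrix.smul_apply, Matrix.diagonal_apply, smul_eq_mul,
    torusWeight]
  split <;> simp

theorem exp_sum_smul_gen (c : Fin 7 → ℂ) : NormedSpace.exp (∑ i, c i • gen (.H i)) =
    Matrix.diagonal fun m => Complex.exp (torusWeight c m) := by
  rw [sum_smul_gen, Matrix.exp_diagonal]
  congr 1
  funext m
  rw [Complex.exp_eq_exp_ℂ, Pi.coe_exp]

/-- This identifies `refl` with the simple reflection `λ ↦ λ - λ(h_i) α_i`, evaluated on `h_j`. -/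
theorem check_refl_weight : ∀ i j n,
    corootP j (refl i n) = corootP j n - cartan j i * corootP i n := by
  decide +kernel

/-- The action of a simple reflection on the coordinates of the Cartan subalgebra. -/
noncomputable def reflCartan (i : Fin 7) (c : Fin 7 → ℂ) : Fin 7 → ℂ :=
  c - Pi.single i (∑ j, c j * (cartan j i : ℂ))

theorem torusWeight_reflCartan (i : Fin 7) (c : Fin 7 → ℂ) (n : Fin 56) :
    torusWeight (reflCartan i c) (code.symm n) = torusWeight c (code.symm (refl i n)) := by
  simp only [torusWeight, reflCartan, Equiv.apply_symm_apply, check_refl_weight, Pi.sub_apply,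
    sub_mul, Finset.sum_sub_distrib, Int.cast_sub, Int.cast_mul, mul_sub]
  congr 1
  rw [Finset.sum_eq_single i]
  · rw [Pi.single_eq_same, Finset.sum_mul]
    simp only [mul_assoc]
  · intro j _ hj
    rw [Pi.single_eq_of_ne hj, zero_mul]
  · simp

/-- Conjugation by the lift acts on the torus through the reflection of the Cartan subalgebra, so it
preserves the generating set of `torus`. -/
theorem reflMat_mul_diagonal (i : Fin 7) (c : Fin 7 → ℂ) :
    reflMat i * (Matrix.diagonal fun m => Complex.exp (torusWeight c m)) =
      (Matrix.diagonal fun m => Complex.exp (torusWeight (reflCartan i c) m)) * reflMat i := by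
  ext m n
  rw [Matrix.mul_diagonal, Matrix.diagonal_mul]
  have h1 : reflMat i m n =
      ((if code m = refl i (code n) then reflSign i (code n) else 0 : ℤ) : ℂ) := by
    simp [reflMat, toM, reflP]
  rw [h1]
  split
  · rename_i e
    have := torusWeight_reflCartan i c (code m)
    rw [Equiv.symm_apply_apply, e, refl_refl, Equiv.symm_apply_apply] at this
    rw [this]
    ring
  · simp

theorem reflCartan_reflCartan (i : Fin 7) (c : Fin 7 → ℂ) :
    torusWeight (reflCartan i (reflCartan i c)) = torusWeight c := by
  funext m
  obtain ⟨n, rfl⟩ := code.symm.surjective m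
  rw [torusWeight_reflCartan, torusWeight_reflCartan, refl_refl]

theorem mem_normalizer_closure {G : Type*} [Group G] (S : Set G) (g : G)
    (h : ∀ s ∈ S, g * s * g⁻¹ ∈ S) (h' : ∀ s ∈ S, g⁻¹ * s * g ∈ S) :
    g ∈ Subgroup.normalizer (Subgroup.closure S : Set G) := by
  have key (g : G) (h : ∀ s ∈ S, g * s * g⁻¹ ∈ S) (x : G) (hx : x ∈ Subgroup.closure S) :
      g * x * g⁻¹ ∈ Subgroup.closure S := by
    have : Subgroup.closure S ≤ (Subgroup.closure S).comap (MulAut.conj g).toMonoidHom :=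
      (Subgroup.closure_le _).2 fun s hs => Subgroup.subset_closure (h s hs)
    exact this hx
  rw [Subgroup.mem_normalizer_iff]
  refine fun x => ⟨key g h x, fun hx => ?_⟩
  have := key g⁻¹ (by simpa using h') _ hx
  simpa [mul_assoc] using this

theorem torus_le_torusNormalizer : torus ≤ torusNormalizer := by
  refine le_inf ?_ Subgroup.le_normalizer
  refine (Subgroup.closure_le _).2 ?_
  rintro g ⟨c, hg⟩
  refine mem_groupE7 g (∑ i, c i • genVec (.H i)) ?_
  rw [hg, map_sum]
  simp only [map_smul, rep_genVec]

/-- The lifts of the simple reflections belong to the normalizer of the torus. -/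
theorem exists_reflection (i : Fin 7) :
    ∃ g ∈ torusNormalizer, (g : Matrix Idx Idx ℂ) = reflMat i := by
  obtain ⟨a, ha, ha'⟩ := exists_unipotent true i 1
  obtain ⟨b, hb, hb'⟩ := exists_unipotent false i (-1)
  have hg : ((a * b * a : GL Idx ℂ) : Matrix Idx Idx ℂ) = reflMat i := by
    rw [Units.val_mul, Units.val_mul, ha', hb', reflMat_eq]
  refine ⟨a * b * a, ⟨mul_mem (mul_mem ha hb) ha, ?_⟩, hg⟩
  generalize a * b * a = g at hg
  apply mem_normalizer_closure
  · rintro s ⟨c, hs⟩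
    refine ⟨reflCartan i c, ?_⟩
    rw [exp_sum_smul_gen] at hs ⊢
    rw [Units.val_mul, Units.val_mul, hs, hg, reflMat_mul_diagonal, ← hg, mul_assoc,
      ← Units.val_mul, mul_inv_cancel, Units.val_one, mul_one]
  · rintro s ⟨c, hs⟩
    refine ⟨reflCartan i c, ?_⟩
    rw [exp_sum_smul_gen] at hs ⊢
    -- The reflection is an involution on torus weights, so the same coordinates serve for
    -- conjugation by the inverse.
    have := reflMat_mul_diagonal i (reflCartan i c)
    rw [reflCartan_reflCartan] at this
    rw [Units.val_mul, Units.val_mul, hs, hg, mul_assoc, ← this, ← hg, ← mul_assoc,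
      ← Units.val_mul, inv_mul_cancel, Units.val_one, one_mul]

/-! ### Coefficients of invariant quartic forms -/

/-- The monomial that is the product of the coordinates with the given numbers. -/
noncomputable def mono (s : Multiset (Fin 56)) : Idx →₀ ℕ := Multiset.toFinsupp (s.map code.symm)

theorem toMultiset_mono (s : Multiset (Fin 56)) :
    Finsupp.toMultiset (mono s) = s.map code.symm := by
  simp [mono]

theorem exists_mono (d : Idx →₀ ℕ) : ∃ s : Multiset (Fin 56), mono s = d ∧ s.card = d.degree := by
  refine ⟨(Finsupp.toMultiset d).map code, ?_, ?_⟩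
  · simp [mono, Multiset.map_map]
  · rw [Multiset.card_map, Finsupp.card_toMultiset, Finsupp.degree_eq_sum]
    exact Finsupp.sum_fintype _ _ fun _ => rfl

theorem mapDomain_mono (σ : Equiv.Perm (Fin 56)) (s : Multiset (Fin 56)) :
    (mono s).mapDomain (fun m => code.symm (σ (code m))) = mono (s.map σ) := by
  apply Multiset.toFinsupp.symm.injective
  change Finsupp.toMultiset _ = Finsupp.toMultiset _
  rw [← Finsupp.toMultiset_map, toMultiset_mono, toMultiset_mono, Multiset.map_map,
    Multiset.map_map]
  simp

theorem prod_mono (f : Idx → ℂ) (s : Multiset (Fin 56)) :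
    (mono s).prod (fun m k => f m ^ k) = (s.map fun n => f (code.symm n)).prod := by
  have := Finsupp.prod_toMultiset ((mono s).mapDomain f)
  rw [← Finsupp.toMultiset_map, toMultiset_mono, Multiset.map_map] at this
  rw [Finsupp.prod_mapDomain_index (fun _ => pow_zero _) fun _ _ _ => pow_add _ _ _] at this
  exact this.symm

/-- The effect of a monomial substitution on the coefficients. -/
theorem coeff_monomial_substitution (σ : Equiv.Perm Idx) (c : Idx → ℂ) (q : MvPolynomial Idx ℂ)
    (d : Idx →₀ ℕ) :
    coeff (d.mapDomain σ) (bind₁ (fun m => C (c m) * X (σ m)) q) =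
      d.prod (fun m k => c m ^ k) * coeff d q := by
  have hinj : Function.Injective (Finsupp.mapDomain σ : (Idx →₀ ℕ) → Idx →₀ ℕ) :=
    Finsupp.mapDomain_injective σ.injective
  induction q using MvPolynomial.induction_on' with
  | monomial e a =>
    have : bind₁ (fun m => C (c m) * X (σ m)) (monomial e a) =
        monomial (e.mapDomain σ) (e.prod (fun m k => c m ^ k) * a) := by
      rw [bind₁_monomial, mul_comm _ a, ← C_mul_monomial]
      congr 1
      rw [monomial_eq, Finsupp.prod_mapDomain_index (by simp) (by intros; exact pow_add _ _ _)]
      simp only [mul_pow, Finsupp.prod, Finset.prod_mul_distrib, map_prod, map_pow]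
    rw [this, coeff_monomial, coeff_monomial]
    by_cases h : e = d
    · subst h
      simp
    · rw [if_neg h, if_neg fun h' => h (hinj h'), mul_zero]
  | add p p' hp hp' => rw [map_add, coeff_add, coeff_add, hp, hp', mul_add]

/-- Over the infinite field `ℂ` equal values give equal polynomials, so invariance under a monomial
matrix can be read off coefficientwise. -/
theorem coeff_eq_of_invariant (σ : Equiv.Perm Idx) (c : Idx → ℂ) (q : MvPolynomial Idx ℂ)
    (h : ∀ v : V, eval (fun m => c m * v (σ m)) q = eval v q) (d : Idx →₀ ℕ) :
    coeff (d.mapDomain σ) q = d.prod (fun m k => c m ^ k) * coeff d q := by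
  rw [← coeff_monomial_substitution]
  congr 1
  apply MvPolynomial.funext
  intro v
  rw [← h, ← coe_aeval_eq_eval, ← coe_aeval_eq_eval, RingHom.coe_coe, RingHom.coe_coe, aeval_bind₁]
  simp

/-- `exp(H_i)` multiplies the monomial by `e^k`, where `k` is the integer total weight. The norm of
`e^k` is not `1` when `k ≠ 0`, so this one element of the torus suffices. -/
theorem coeff_mono_eq_zero_of_weight (q : MvPolynomial Idx ℂ) (h : IsInvariant torus q)
    (s : Multiset (Fin 56)) (i : Fin 7) (hs : (s.map (corootP i)).sum ≠ 0) :
    coeff (mono s) q = 0 := by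
  let c : Fin 7 → ℂ := Pi.single i 1
  have hc (m : Idx) : torusWeight c m = corootP i (code m) := by
    simp [torusWeight, c, Pi.single_apply]
  obtain ⟨g, hg⟩ := Matrix.isUnit_exp (∑ i, c i • gen (.H i))
  have hgT : g ∈ torus := Subgroup.subset_closure ⟨c, hg⟩
  have h1 := coeff_eq_of_invariant (Equiv.refl _) (fun m => Complex.exp (torusWeight c m)) q
    (fun v => by
      rw [← h g hgT v, hg, exp_sum_smul_gen]
      congr 2
      funext m
      rw [Matrix.mulVec_diagonal]
      rfl) (mono s)
  rw [Equiv.coe_refl, Finsupp.mapDomain_id, prod_mono] at h1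
  have h2 : (s.map fun n => Complex.exp (torusWeight c (code.symm n))).prod =
      Complex.exp ((s.map (corootP i)).sum : ℤ) := by
    simp only [hc, Equiv.apply_symm_apply]
    clear h1 hs
    induction s using Multiset.induction_on with
    | empty => simp
    | cons a s ih => simp [ih, Complex.exp_add]
  rw [h2] at h1
  have h3 : Complex.exp ((s.map (corootP i)).sum : ℤ) ≠ 1 := by
    intro h3
    have := congrArg norm h3
    rw [Complex.norm_exp, Complex.intCast_re, norm_one, Real.exp_eq_one_iff] at this
    exact hs (by exact_mod_cast this)
  by_contra h4
  exact h3 (mul_right_cancel₀ h4 (by rw [← h1, one_mul]))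

/-- A simple reflection, as a permutation of the weights. -/
def reflPerm (i : Fin 7) : Equiv.Perm (Fin 56) :=
  ⟨refl i, refl i, refl_refl i, refl_refl i⟩

/-- The two coefficients differ by a product of signs. Only its being nonzero matters, so no sign is
tracked along an orbit. -/
theorem coeff_mono_refl (q : MvPolynomial Idx ℂ) (h : IsWeylInvariant q) (i : Fin 7)
    (s : Multiset (Fin 56)) (hs : coeff (mono (s.map (refl i))) q = 0) :
    coeff (mono s) q = 0 := by
  obtain ⟨g, hg, hg'⟩ := exists_reflection i
  have h1 := coeff_eq_of_invariant (code.trans ((reflPerm i).trans code.symm))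
    (fun m => (reflSign i (refl i (code m)) : ℂ)) q (fun v => by
      rw [← h g hg v, hg']
      congr 2
      funext m
      rw [reflMat_mulVec]
      rfl) (mono s)
  rw [show (code.trans ((reflPerm i).trans code.symm) : Idx → Idx) =
    fun m => code.symm (reflPerm i (code m)) from rfl, mapDomain_mono] at h1
  change coeff (mono (s.map (refl i))) q = _ at h1
  rw [hs, prod_mono] at h1
  refine (mul_eq_zero.1 h1.symm).resolve_left ?_
  rw [Multiset.prod_eq_zero_iff, Multiset.mem_map]
  rintro ⟨n, -, hn⟩
  exact reflSign_ne_zero _ _ (Int.cast_eq_zero.1 hn)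

/-! ### Orbits of the Weyl group on the monomials of weight zero -/

/-- The height of a weight, measured from the highest weight, which has number `48`. -/
def depth (n : Fin 56) : ℕ :=
  [4, 21, 5, 22, 5, 22, 6, 23, 12, 13, 13, 14, 13, 14, 14, 15, 6, 11, 15, 20, 7, 12, 16, 21, 8, 17,
    9, 18, 9, 18, 10, 19, 10, 15, 11, 16, 11, 16, 12, 17, 2, 7, 3, 8, 19, 24, 20, 25, 0, 9, 1, 10,
    17, 26, 18, 27].getD n 0

/-- By descent on `depth`, every weight can be moved to the highest one. -/
theorem check_first : ∀ a : Fin 56, a = 48 ∨ ∃ i, depth (refl i a) < depth a := by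
  decide +kernel

/-- The stabilizer of the highest weight is of type `E₆`; its orbits on the 56 weights have sizes 1,
27, 27, 1, which gives four representatives. -/
theorem check_second : ∀ b : Fin 56, b ∈ ([48, 50, 51, 55] : List (Fin 56)) ∨
    ∃ i, refl i 48 = 48 ∧ depth (refl i b) < depth b := by
  decide +kernel

/-- The orbits of the stabilizer of the weights `48` and `b`. -/
def orbitReps (b : Fin 56) : List (Fin 56) :=
  if b = 50 then [18, 40, 48, 49, 50, 51, 53, 55]
  else if b = 51 then [16, 34, 48, 50, 51, 52, 54, 55]
  else [48, 50, 51, 55]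

theorem check_third : ∀ b ∈ ([48, 50, 51, 55] : List (Fin 56)), ∀ c : Fin 56, c ∈ orbitReps b ∨
    ∃ i, refl i 48 = 48 ∧ refl i b = b ∧ depth (refl i c) < depth c := by
  decide +kernel

/-- Words in the simple reflections. -/
def words : List (List (Fin 7)) :=
  [[6, 5, 4, 3], [5, 4, 3, 1, 6, 5, 4, 3], [0, 2, 3, 1, 4, 3, 2, 0, 5, 4, 3, 2, 6, 5, 4, 3]]

/-- Representatives of the orbits on the monomials of weight zero. -/
def monoReps : List (List (Fin 56)) := [[0, 0, 7, 7], [0, 7, 4, 3], [0, 3, 5, 6]]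

/-- The action of a word on a weight. -/
def wordAct (w : List (Fin 7)) (n : Fin 56) : Fin 56 := w.foldl (fun n i => refl i n) n

/-- The fourth weight is not normalized further; all 56 possibilities are examined. -/
theorem check_fourth : ∀ b ∈ ([48, 50, 51, 55] : List (Fin 56)), ∀ c ∈ orbitReps b, ∀ d : Fin 56,
    (∃ i, corootP i 48 + corootP i b + corootP i c + corootP i d ≠ 0) ∨
      ∃ w ∈ words, ∃ r ∈ monoReps, ([48, b, c, d].map (wordAct w)).Perm r := by
  decide +kernel

/-- A property of quadruples of weights holds for all of them if it can be transported along simple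
reflections and holds for the quadruples of nonzero weight and for three quadruples of weight
zero. -/
theorem quadruple_induction (P : Multiset (Fin 56) → Prop)
    (hP : ∀ i s, P (s.map (refl i)) → P s) (hT : ∀ i s, (s.map (corootP i)).sum ≠ 0 → P s)
    (hr : ∀ r ∈ monoReps, P r) (s : Multiset (Fin 56)) (hs : s.card = 4) : P s := by
  have hw (w : List (Fin 7)) (s : Multiset (Fin 56)) (h : P (s.map (wordAct w))) : P s := by
    induction w generalizing s with
    | nil => exact (Multiset.map_id s) ▸ h
    | cons i w ih =>
      apply hP i
      apply ih
      rw [Multiset.map_map]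
      exact h
  have hP' (i : Fin 7) (a b c d : Fin 56)
      (h : P {refl i a, refl i b, refl i c, refl i d}) : P {a, b, c, d} := by
    apply hP i
    simpa using h
  have h4 (b c d : Fin 56) (hb : b ∈ ([48, 50, 51, 55] : List (Fin 56))) (hc : c ∈ orbitReps b) :
      P {48, b, c, d} := by
    rcases check_fourth b hb c hc d with ⟨i, hi⟩ | ⟨w, -, r, hr', h⟩
    · apply hT i
      simpa [add_assoc] using hi
    · apply hw w
      have h1 : (({48, b, c, d} : Multiset (Fin 56)).map (wordAct w)) = (r : Multiset (Fin 56)) :=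
        Multiset.coe_eq_coe.2 h
      rw [h1]
      exact hr r hr'
  -- Each descent uses only reflections that fix the weights already normalized, so those stay in
  -- place while `depth` of the next weight decreases.
  have h3 (n : ℕ) : ∀ b c d : Fin 56, depth c = n → b ∈ ([48, 50, 51, 55] : List (Fin 56)) →
      P {48, b, c, d} := by
    induction n using Nat.strong_induction_on with
    | _ n ih =>
      intro b c d hn hb
      rcases check_third b hb c with hc | ⟨i, h1, h2, h3⟩
      · exact h4 b c d hb hc
      · apply hP' i
        rw [h1, h2]
        exact ih _ (hn ▸ h3) _ _ _ rfl hb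
  have h2 (n : ℕ) : ∀ b c d : Fin 56, depth b = n → P {48, b, c, d} := by
    induction n using Nat.strong_induction_on with
    | _ n ih =>
      intro b c d hn
      rcases check_second b with hb | ⟨i, h1, h2⟩
      · exact h3 _ b c d rfl hb
      · apply hP' i
        rw [h1]
        exact ih _ (hn ▸ h2) _ _ _ rfl
  have h1 (n : ℕ) : ∀ a b c d : Fin 56, depth a = n → P {a, b, c, d} := by
    induction n using Nat.strong_induction_on with
    | _ n ih =>
      intro a b c d hn
      rcases check_first a with rfl | ⟨i, h1⟩
      · exact h2 _ b c d rfl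
      · apply hP' i
        exact ih _ (hn ▸ h1) _ _ _ _ rfl
  obtain ⟨a, t, rfl⟩ := Multiset.card_pos_iff_exists_mem.1 (by omega : 0 < s.card) |>.imp
    fun a ha => Multiset.exists_cons_of_mem ha
  obtain ⟨b, c, d, rfl⟩ := Multiset.card_eq_three.1 (by simpa using hs : t.card = 3)
  exact h1 _ a b c d rfl

/-- A quartic form that is invariant under the Weyl group vanishes if three of its coefficients
do. -/
theorem eq_zero_of_isWeylInvariant (q : MvPolynomial Idx ℂ) (hq : q.IsHomogeneous 4)
    (h : IsWeylInvariant q) (hr : ∀ r ∈ monoReps, coeff (mono r) q = 0) : q = 0 := by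
  ext d
  rw [coeff_zero]
  by_contra hd
  have h4 : d.degree = 4 := by
    rw [Finsupp.degree_eq_weight_one]
    exact hq hd
  obtain ⟨s, rfl, hs⟩ := exists_mono d
  apply hd
  exact quadruple_induction (fun s => coeff (mono s) q = 0) (fun i s => coeff_mono_refl q h i s)
    (fun i s => coeff_mono_eq_zero_of_weight q
      (fun g hg => h g (torus_le_torusNormalizer hg)) s i) hr s (hs.trans h4)

/-! ### Test vectors on the first line -/

/-- The vector with given integral coordinates. -/
noncomputable def vec (f : Fin 56 → ℤ) : V := fun m => (f (code m) : ℂ)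

/-- A monomial with a factor outside `S` vanishes at the test vector, and those inside `S` other
than `r` have coefficient zero, so the value isolates the coefficient of `r`. -/
theorem eval_vec (q : MvPolynomial Idx ℂ) (hq : q.IsHomogeneous 4) (S : List (Fin 56))
    (r : List (Fin 56))
    (hS : ∀ a ∈ S, ∀ b ∈ S, ∀ c ∈ S, ∀ d ∈ S,
      [a, b, c, d].Perm r ∨ coeff (mono ([a, b, c, d] : List (Fin 56))) q = 0)
    (f : Fin 56 → ℤ) (hf : ∀ n, n ∉ S → f n = 0) :
    eval (vec f) q = coeff (mono r) q * ((r.map f).prod : ℤ) := by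
  have hprod (s : Multiset (Fin 56)) : ∏ i ∈ (mono s).support, vec f i ^ mono s i =
      ((s.map f).prod : ℤ) := by
    refine (prod_mono (vec f) s).trans ?_
    simp only [vec, Equiv.apply_symm_apply]
    induction s using Multiset.induction_on with
    | empty => simp
    | cons a s ih => simp only [Multiset.map_cons, Multiset.prod_cons, ih, Int.cast_mul]
  rw [eval_eq, Finset.sum_eq_single (mono r), hprod]
  · simp
  · intro d hd hdr
    have h4 : d.degree = 4 := by
      rw [Finsupp.degree_eq_weight_one]
      exact hq (mem_support_iff.1 hd)
    obtain ⟨s, rfl, hs⟩ := exists_mono d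
    rw [hprod]
    rw [h4] at hs
    by_cases h : ∀ n ∈ s, n ∈ S
    · obtain ⟨a, t, rfl⟩ := Multiset.card_pos_iff_exists_mem.1 (by omega : 0 < s.card) |>.imp
        fun a ha => Multiset.exists_cons_of_mem ha
      obtain ⟨b, c, e, rfl⟩ := Multiset.card_eq_three.1 (by simpa using hs : t.card = 3)
      rcases hS a (h a (by simp)) b (h b (by simp)) c (h c (by simp)) e (h e (by simp)) with h' | h'
      · exact absurd (congrArg mono (Multiset.coe_eq_coe.2 h')) hdr
      · exact mul_eq_zero_of_left h' _
    · push Not at h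
      obtain ⟨n, hn, hn'⟩ := h
      rw [Multiset.prod_eq_zero (Multiset.mem_map.2 ⟨n, hn, hf n hn'⟩)]
      simp
  · intro h
    rw [notMem_support_iff.1 h, zero_mul]

theorem eval_vec_of_restrictsTo (q : MvPolynomial Idx ℂ) (h : RestrictsTo q 0 0)
    (f : Fin 56 → ℤ) (hf : ∀ n, (code.symm n).1 ≠ 0 → f n = 0) : eval (vec f) q = 0 := by
  have : vec f = incl 0 fun s => (f (code (0, s)) : ℂ) := by
    funext m
    unfold incl vec
    split
    · rename_i e
      rw [← e]
    · rename_i e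
      rw [hf, Int.cast_zero]
      rwa [Equiv.symm_apply_apply]
  rw [this, h, zero_mul]

/-- The action of `1 + x` on vectors, where `x` is the opposite of the simple root vector with
label `b`, or the simple root vector. -/
def unipotentAct (b : Bool) (i : Fin 7) (f : Fin 56 → ℤ) (n : Fin 56) : ℤ :=
  f n + match chevP b i n with
    | none => 0
    | some (k, c) => c * f k

theorem mulVec_vec (b : Bool) (i : Fin 7) (f : Fin 56 → ℤ) :
    (1 + (1 : ℂ) • simpleOp (!b) i).mulVec (vec f) = vec (unipotentAct b i f) := by
  funext m
  obtain ⟨n, rfl⟩ := code.symm.surjective m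
  rw [one_smul, Matrix.add_mulVec, Matrix.one_mulVec, Pi.add_apply]
  simp only [vec, unipotentAct, Equiv.apply_symm_apply, Int.cast_add]
  congr 1
  rw [Matrix.mulVec, dotProduct, ← code.symm.sum_comp]
  have h (k : Fin 56) : toM (chevP (!b) i) n k = toM (chevP b i) k n := by
    rw [toM_apply_eq, Bool.not_not]
  simp only [simpleOp_apply, Equiv.apply_symm_apply, h, vec]
  simp only [toM]
  rcases chevP b i n with _ | ⟨k, c⟩
  · simp
  · simp

theorem eval_vec_unipotentAct (q : MvPolynomial Idx ℂ) (h : IsE7Invariant q) (b : Bool)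
    (i : Fin 7) (f : Fin 56 → ℤ) : eval (vec (unipotentAct b i f)) q = eval (vec f) q := by
  obtain ⟨g, hg, hg'⟩ := exists_unipotent (!b) i 1
  rw [← mulVec_vec, ← hg']
  exact h g hg _

theorem isWeylInvariant_of_isE7Invariant (q : MvPolynomial Idx ℂ) (h : IsE7Invariant q) :
    IsWeylInvariant q :=
  fun g hg => h g hg.1

theorem coeff_mono_wordAct (q : MvPolynomial Idx ℂ) (h : IsWeylInvariant q) (w : List (Fin 7))
    (s : Multiset (Fin 56)) (hs : coeff (mono (s.map (wordAct w))) q = 0) :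
    coeff (mono s) q = 0 := by
  induction w generalizing s with
  | nil => exact (Multiset.map_id s) ▸ hs
  | cons i w ih =>
    apply coeff_mono_refl q h i
    apply ih
    rw [Multiset.map_map]
    exact hs

/-- The indicator function of a list. -/
def indicator (S : List (Fin 56)) (n : Fin 56) : ℤ := if n ∈ S then 1 else 0

/-- A monomial has nonzero weight, or is moved to one of the monomials in `R` by one of the words
in `W`. -/
def Reduces (W : List (List (Fin 7))) (R : List (List (Fin 56))) (s : List (Fin 56)) : Prop :=
  (∃ i, (s.map (corootP i)).sum ≠ 0) ∨ ∃ w ∈ W, ∃ r ∈ R, (s.map (wordAct w)).Perm r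

instance (W : List (List (Fin 7))) (R : List (List (Fin 56))) (s : List (Fin 56)) :
    Decidable (Reduces W R s) :=
  inferInstanceAs (Decidable (_ ∨ _))

theorem coeff_of_reduces (q : MvPolynomial Idx ℂ) (h : IsWeylInvariant q)
    (W : List (List (Fin 7))) (R : List (List (Fin 56))) (hR : ∀ r ∈ R, coeff (mono r) q = 0)
    (s : List (Fin 56)) (hs : Reduces W R s) : coeff (mono s) q = 0 := by
  rcases hs with ⟨i, hi⟩ | ⟨w, -, r, hr, hw⟩
  · exact coeff_mono_eq_zero_of_weight q (fun g hg => h g (torus_le_torusNormalizer hg)) s i hi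
  · apply coeff_mono_wordAct q h w
    have : (s : Multiset (Fin 56)).map (wordAct w) = r := Multiset.coe_eq_coe.2 hw
    rw [this]
    exact hR r hr

theorem check_squares : ∀ a ∈ ([0, 7] : List (Fin 56)), ∀ b ∈ ([0, 7] : List (Fin 56)),
    ∀ c ∈ ([0, 7] : List (Fin 56)), ∀ d ∈ ([0, 7] : List (Fin 56)),
    [a, b, c, d].Perm [0, 0, 7, 7] ∨ Reduces [] [] [a, b, c, d] := by
  decide +kernel

/-- The other monomials of weight zero in these variables are `x₀² x₇²` and `x₃² x₄²`; the
reflection numbered `1` exchanges them. -/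
theorem check_pairs : ∀ a ∈ ([0, 7, 4, 3] : List (Fin 56)),
    ∀ b ∈ ([0, 7, 4, 3] : List (Fin 56)), ∀ c ∈ ([0, 7, 4, 3] : List (Fin 56)),
    ∀ d ∈ ([0, 7, 4, 3] : List (Fin 56)),
    [a, b, c, d].Perm [0, 7, 4, 3] ∨ Reduces [[], [1]] [[0, 0, 7, 7]] [a, b, c, d] := by
  decide +kernel

/-- Words that move the monomials of weight zero on the first line. -/
def lineWords : List (List (Fin 7)) :=
  [[], [1], [2], [1, 2], [3, 2, 1, 3],
    [0, 2, 3, 4, 5, 6, 0, 2, 1, 3, 4, 5, 2, 1, 3, 4, 0, 2, 3, 0, 2]]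

/-- Leaving out the coordinate `1` excludes `x₁ x₂ x₄ x₇`, so that `x₀ x₃ x₅ x₆` is the only
monomial of its kind. The remaining ones of weight zero are squares of an opposite pair or products
of two opposite pairs. -/
theorem check_quads : ∀ a ∈ ([0, 2, 3, 4, 5, 6, 7] : List (Fin 56)),
    ∀ b ∈ ([0, 2, 3, 4, 5, 6, 7] : List (Fin 56)), ∀ c ∈ ([0, 2, 3, 4, 5, 6, 7] : List (Fin 56)),
    ∀ d ∈ ([0, 2, 3, 4, 5, 6, 7] : List (Fin 56)),
    [a, b, c, d].Perm [0, 3, 5, 6] ∨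
      Reduces lineWords [[0, 0, 7, 7], [0, 7, 4, 3]] [a, b, c, d] := by
  decide +kernel

theorem eval_vec_squares (q : MvPolynomial Idx ℂ) (hq : q.IsHomogeneous 4)
    (h : IsWeylInvariant q) (f : Fin 56 → ℤ) (hf : ∀ n, n ∉ ([0, 7] : List (Fin 56)) → f n = 0) :
    eval (vec f) q = coeff (mono ([0, 0, 7, 7] : List (Fin 56))) q *
      ((([0, 0, 7, 7] : List (Fin 56)).map f).prod : ℤ) :=
  eval_vec q hq _ _ (fun a ha b hb c hc d hd => (check_squares a ha b hb c hc d hd).imp_right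
    (coeff_of_reduces q h _ _ (by simp) _)) f hf

theorem eval_vec_pairs (q : MvPolynomial Idx ℂ) (hq : q.IsHomogeneous 4)
    (h : IsWeylInvariant q) (h0 : coeff (mono ([0, 0, 7, 7] : List (Fin 56))) q = 0)
    (f : Fin 56 → ℤ) (hf : ∀ n, n ∉ ([0, 7, 4, 3] : List (Fin 56)) → f n = 0) :
    eval (vec f) q = coeff (mono ([0, 7, 4, 3] : List (Fin 56))) q *
      ((([0, 7, 4, 3] : List (Fin 56)).map f).prod : ℤ) :=
  eval_vec q hq _ _ (fun a ha b hb c hc d hd => (check_pairs a ha b hb c hc d hd).imp_right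
    (coeff_of_reduces q h _ _ (by simpa using h0) _)) f hf

theorem eval_vec_quads (q : MvPolynomial Idx ℂ) (hq : q.IsHomogeneous 4)
    (h : IsWeylInvariant q) (h0 : coeff (mono ([0, 0, 7, 7] : List (Fin 56))) q = 0)
    (h1 : coeff (mono ([0, 7, 4, 3] : List (Fin 56))) q = 0) (f : Fin 56 → ℤ)
    (hf : ∀ n, n ∉ ([0, 2, 3, 4, 5, 6, 7] : List (Fin 56)) → f n = 0) :
    eval (vec f) q = coeff (mono ([0, 3, 5, 6] : List (Fin 56))) q *
      ((([0, 3, 5, 6] : List (Fin 56)).map f).prod : ℤ) :=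
  eval_vec q hq _ _ (fun a ha b hb c hc d hd => (check_quads a ha b hb c hc d hd).imp_right
    (coeff_of_reduces q h _ _ (by simpa using ⟨h0, h1⟩) _)) f hf

/-- A quartic form that is invariant under the Weyl group and vanishes on the factor of the first
line is zero. -/
theorem eq_zero_of_restrictsTo_zero (q : MvPolynomial Idx ℂ) (hq : q.IsHomogeneous 4)
    (h : IsWeylInvariant q) (h0 : RestrictsTo q 0 0) : q = 0 := by
  -- Each test vector isolates one coefficient once the preceding ones are known to vanish.
  have h1 : coeff (mono ([0, 0, 7, 7] : List (Fin 56))) q = 0 := by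
    have := eval_vec_squares q hq h (indicator [0, 7]) (by decide +kernel)
    rw [eval_vec_of_restrictsTo q h0 _ (by decide +kernel)] at this
    simpa [indicator] using this.symm
  have h2 : coeff (mono ([0, 7, 4, 3] : List (Fin 56))) q = 0 := by
    have := eval_vec_pairs q hq h h1 (indicator [0, 7, 4, 3]) (by decide +kernel)
    rw [eval_vec_of_restrictsTo q h0 _ (by decide +kernel)] at this
    simpa [indicator] using this.symm
  have h3 : coeff (mono ([0, 3, 5, 6] : List (Fin 56))) q = 0 := by
    have := eval_vec_quads q hq h h1 h2 (indicator [0, 3, 5, 6]) (by decide +kernel)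
    rw [eval_vec_of_restrictsTo q h0 _ (by decide +kernel)] at this
    simpa [indicator] using this.symm
  exact eq_zero_of_isWeylInvariant q hq h (by simpa [monoReps] using ⟨h1, h2, h3⟩)

/-- An `E₇`-invariant quartic form without the monomial `x_{000}² x_{111}²` on the first line is
zero. -/
theorem eq_zero_of_isE7Invariant (q : MvPolynomial Idx ℂ) (hq : q.IsHomogeneous 4)
    (h : IsE7Invariant q) (h1 : coeff (mono ([0, 0, 7, 7] : List (Fin 56))) q = 0) : q = 0 := by
  have hW := isWeylInvariant_of_isE7Invariant q h
  have h2 : coeff (mono ([0, 7, 4, 3] : List (Fin 56))) q = 0 := by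
    -- The unipotent adds coordinate 4 to 0 and coordinate 7 to 3. The product of the coordinates 0,
    -- 7, 4, 3 changes from 0 to 2 while `q` keeps its value.
    have := eval_vec_unipotentAct q h false 1 (indicator [0, 7, 4])
    rw [eval_vec_pairs q hq hW h1 _ (by decide +kernel),
      eval_vec_pairs q hq hW h1 _ (by decide +kernel),
      show (([0, 7, 4, 3] : List (Fin 56)).map (unipotentAct false 1 (indicator [0, 7, 4]))).prod
        = 2 by decide +kernel,
      show (([0, 7, 4, 3] : List (Fin 56)).map (indicator [0, 7, 4])).prod = 0 by
        decide +kernel] at this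
    simpa using this
  have h3 : coeff (mono ([0, 3, 5, 6] : List (Fin 56))) q = 0 := by
    -- The coordinates 0, 1, 2, 3 are added to 4, 5, 6, 7. The result is 1 on every coordinate of
    -- the first line except coordinate 1, which stays 0, and the product over 0, 3, 5, 6 changes
    -- from 0 to 1.
    have := eval_vec_unipotentAct q h true 1 (indicator [0, 3, 5, 2])
    rw [eval_vec_quads q hq hW h1 h2 _ (by decide +kernel),
      eval_vec_quads q hq hW h1 h2 _ (by decide +kernel),
      show (([0, 3, 5, 6] : List (Fin 56)).map
        (unipotentAct true 1 (indicator [0, 3, 5, 2]))).prod = 1 by decide +kernel,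
      show (([0, 3, 5, 6] : List (Fin 56)).map (indicator [0, 3, 5, 2])).prod = 0 by
        decide +kernel] at this
    simpa using this
  exact eq_zero_of_isWeylInvariant q hq hW (by simpa [monoReps] using ⟨h1, h2, h3⟩)

/-! ### The characterization of the invariant quartic -/

theorem IsInvariant.sub_smul {K : Subgroup (GL Idx ℂ)} {p q : MvPolynomial Idx ℂ}
    (hp : IsInvariant K p) (hq : IsInvariant K q) (c : ℂ) : IsInvariant K (p - c • q) := by
  intro g hg v
  rw [map_sub, map_sub, smul_eval, smul_eval, hp g hg, hq g hg]

theorem IsInvariant.smul {K : Subgroup (GL Idx ℂ)} {q : MvPolynomial Idx ℂ}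
    (hq : IsInvariant K q) (c : ℂ) : IsInvariant K (c • q) := by
  intro g hg v
  rw [smul_eval, smul_eval, hq g hg]

theorem isHomogeneous_sub_smul {q : MvPolynomial Idx ℂ} (hq : q.IsHomogeneous 4) (c : ℂ) :
    (q - c • quartic).IsHomogeneous 4 := by
  refine hq.sub ?_
  rw [smul_eq_C_mul]
  have := (isHomogeneous_C Idx c).mul (listPoly_isHomogeneous quarticTerms)
  rwa [zero_add] at this

theorem isE7Invariant_iff (q : MvPolynomial Idx ℂ) (hq : q.IsHomogeneous 4) :
    IsE7Invariant q ↔ ∃ c : ℂ, q = c • quartic := by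
  constructor
  · intro h
    have h0 : coeff (mono ([0, 0, 7, 7] : List (Fin 56))) quartic ≠ 0 := fun h0 =>
      quartic_ne_zero (eq_zero_of_isE7Invariant _ (listPoly_isHomogeneous _) quartic_invariant h0)
    refine ⟨coeff (mono ([0, 0, 7, 7] : List (Fin 56))) q /
      coeff (mono ([0, 0, 7, 7] : List (Fin 56))) quartic, sub_eq_zero.1 ?_⟩
    apply eq_zero_of_isE7Invariant _ (isHomogeneous_sub_smul hq _)
      (IsInvariant.sub_smul h quartic_invariant _)
    rw [coeff_sub, coeff_smul, smul_eq_mul, div_mul_cancel₀ _ h0, sub_self]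
  · rintro ⟨c, rfl⟩
    exact IsInvariant.smul quartic_invariant c

/-- The scalar is read off on the first line alone: after subtracting that multiple of `quartic`,
the restriction there is zero, which forces the form to vanish. -/
theorem isWeylInvariant_and_restrictsTo_iff (q : MvPolynomial Idx ℂ) (hq : q.IsHomogeneous 4) :
    (IsWeylInvariant q ∧ ∀ l : Fin 7, ∃ c : ℂ, RestrictsTo q l c) ↔ ∃ c : ℂ, q = c • quartic := by
  have hQ := isWeylInvariant_of_isE7Invariant _ quartic_invariant
  constructor
  · rintro ⟨h, h'⟩
    obtain ⟨c, hc⟩ := h' 0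
    refine ⟨c, sub_eq_zero.1 ?_⟩
    apply eq_zero_of_restrictsTo_zero _ (isHomogeneous_sub_smul hq c)
      (IsInvariant.sub_smul h hQ c)
    intro a
    rw [map_sub, smul_eval, hc, quartic_restrictsTo]
    ring
  · rintro ⟨c, rfl⟩
    refine ⟨IsInvariant.smul hQ c, fun l => ⟨c, fun a => ?_⟩⟩
    rw [smul_eval, quartic_restrictsTo, one_mul]

/-! ### The subalgebra `×_i 𝔰𝔩(A_i)` -/

/-- The commutator of two partial maps, if their compositions are nowhere both defined. -/
def lieP (P Q : PMap) : PMap := fun n =>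
  match comp P Q n with
  | some a => some a
  | none =>
    match comp Q P n with
    | some a => some (a.1, -a.2)
    | none => none

theorem toM_lieP (P Q : PMap) (h : ∀ n, comp P Q n = none ∨ comp Q P n = none) :
    ⁅toM P, toM Q⁆ = toM (lieP P Q) := by
  rw [Ring.lie_def, toM_mul, toM_mul]
  ext m n
  rw [Matrix.sub_apply]
  simp only [toM, lieP]
  rcases h n with h | h
  · rcases h' : comp Q P n with _ | a
    · simp [h]
    · simp only [h, zero_sub]
      split <;> simp
  · rcases h' : comp P Q n with _ | a
    · simp [h]
    · simp [h]

/-- Iterated commutators of the simple root vectors, or of their opposites. -/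
def wordP (b : Bool) : List (Fin 7) → PMap
  | [] => fun _ => none
  | [i] => chevP b i
  | i :: w => lieP (chevP b i) (wordP b w)

/-- The positive roots of the `𝔰𝔩(A_i)` as iterated commutators of simple roots. -/
def slWord : Fin 7 → List (Fin 7) :=
  ![[1], [2], [0, 2, 3, 4, 5, 6, 1, 3, 4, 5, 2, 3, 4, 1, 3, 2, 0], [4], [6],
    [5, 6, 4, 5, 3, 4, 2, 3, 1], [3, 4, 2, 3, 1]]

/-- At every stage of the iterated bracket at most one of the two products is defined on a given
weight, so the bracket is again a partial map. The default letter `0` occurs only for the empty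
word, whose partial map is nowhere defined. -/
theorem check_slWord : ∀ b i, ∀ w ∈ (slWord i).tails, ∀ n,
    comp (chevP b (w.headD 0)) (wordP b w.tail) n = none ∨
      comp (wordP b w.tail) (chevP b (w.headD 0)) n = none := by
  decide +kernel

/-- The operators `slOp` as partial maps. -/
def slP (b : Bool) (i : Fin 7) : PMap := fun n =>
  let m := code.symm n
  ((List.finRange 3).find? fun p => line m.1 p = i ∧ m.2 p = if b then 1 else 0).map fun p =>
    (code (m.1, fun q => if q = p then (if b then 0 else 1) else m.2 q), 1)

/-- The sign by which an iterated commutator differs from `slOp`. -/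
def slSign (i : Fin 7) : ℤ := if i = 2 then -1 else 1

theorem check_slP : ∀ b i n,
    wordP b (slWord i) n = (slP b i n).map fun a => (a.1, slSign i * a.2) := by
  decide +kernel

theorem check_slP_none : ∀ b i n, slP b i n = none →
    (linWt[n.val]?.getD 0) + lin (Pi.single i (2 * sg b)) ∉ linWt := by
  decide +kernel

theorem check_slP_some : ∀ b i n, ∀ a ∈ slP b i n,
    wt (code.symm a.1) = wt (code.symm n) + Pi.single i (2 * sg b) ∧ 1 = a.2 := by
  decide +kernel

theorem slOp_eq (b : Bool) (i : Fin 7) :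
    slOp i (sg b) = (toM (slP b i)).submatrix code code := by
  apply eq_toM (c := fun _ => 1)
  · intro n h
    have := check_slP_none b i n h
    rwa [lin_wt n, Option.getD_some] at this
  · exact check_slP_some b i

/-- The matrix units of `𝔤𝔩(A_i)` acting on `V`. -/
def slUnit (i : Fin 7) (a b : Fin 2) : Matrix Idx Idx ℤ := fun m n =>
  if m.1 = n.1 then
    ∑ p : Fin 3, if (line n.1 p = i ∧ ∀ q, q ≠ p → m.2 q = n.2 q) ∧ m.2 p = a ∧ n.2 p = b
      then 1 else 0
  else 0

theorem check_slP_diag : ∀ b i n,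
    comp (slP b i) (slP (!b) i) n = none ∨
      comp (slP b i) (slP (!b) i) n = some (n, coef (comp (slP b i) (slP (!b) i)) n) := by
  decide +kernel

/-- The diagonal entries of the operators of the coroots of the `𝔰𝔩(A_i)`. -/
def slCorootP (i : Fin 7) (n : Fin 56) : ℤ :=
  coef (comp (slP true i) (slP false i)) n - coef (comp (slP false i) (slP true i)) n

theorem lie_slOp (i : Fin 7) :
    ⁅slOp i (sg true), slOp i (sg false)⁆ = Matrix.diagonal (slCorootP i ∘ code) := by
  rw [Ring.lie_def, slOp_eq, slOp_eq, sub_mul_sub, sub_mul_sub, toM_mul, toM_mul,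
    toM_diag (comp (slP true i) (slP false i)) (check_slP_diag true i),
    toM_diag (comp (slP false i) (slP true i)) (check_slP_diag false i),
    Matrix.submatrix_diagonal_equiv, Matrix.submatrix_diagonal_equiv, Matrix.diagonal_sub]
  rfl

set_option maxRecDepth 100000 in
theorem check_slUnit_offDiag : ∀ (b : Bool) (i : Fin 7) (m n : Fin 56),
    (slUnit i (if b then 0 else 1) (if b then 1 else 0) (code.symm m) (code.symm n) ==
      toM (slP b i) m n) = true := by
  decide +kernel

set_option maxRecDepth 100000 in
theorem check_slUnit_diag : ∀ (i : Fin 7) (m n : Fin 56),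
    (slUnit i 0 0 (code.symm m) (code.symm n) - slUnit i 1 1 (code.symm m) (code.symm n) ==
      if m = n then slCorootP i m else 0) = true := by
  decide +kernel

theorem slUnit_offDiag (b : Bool) (i : Fin 7) :
    slUnit i (if b then 0 else 1) (if b then 1 else 0) = slOp i (sg b) := by
  rw [slOp_eq]
  ext m n
  have := check_slUnit_offDiag b i (code m) (code n)
  rw [beq_iff_eq, Equiv.symm_apply_apply, Equiv.symm_apply_apply] at this
  exact this

theorem slUnit_diag (i : Fin 7) :
    slUnit i 0 0 - slUnit i 1 1 = ⁅slOp i (sg true), slOp i (sg false)⁆ := by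
  rw [lie_slOp]
  ext m n
  have := check_slUnit_diag i (code m) (code n)
  rw [beq_iff_eq, Equiv.symm_apply_apply, Equiv.symm_apply_apply] at this
  rw [Matrix.sub_apply, this, Matrix.diagonal_apply]
  simp only [code.injective.eq_iff, Function.comp_apply]

theorem slAct_eq_sum (i : Fin 7) (X : Matrix (Fin 2) (Fin 2) ℂ) :
    slAct i X = ∑ a, ∑ b, X a b • (Int.castRingHom ℂ).mapMatrix (slUnit i a b) := by
  ext m n
  simp only [Matrix.sum_apply, Matrix.smul_apply, RingHom.mapMatrix_apply, Matrix.map_apply,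
    slAct, slUnit]
  split
  · simp only [map_sum, smul_eq_mul, Finset.mul_sum]
    rw [Finset.sum_congr rfl fun a _ => Finset.sum_comm, Finset.sum_comm]
    refine Finset.sum_congr rfl fun p _ => ?_
    by_cases h : line n.1 p = i ∧ ∀ q, q ≠ p → m.2 q = n.2 q
    · rw [if_pos h]
      have h' := eq_true h
      simp only [h', true_and, apply_ite, map_one, map_zero, mul_one, mul_zero, ite_and]
      simp
    · rw [if_neg h]
      simp only [h, false_and, if_false, map_zero, mul_zero, Finset.sum_const_zero]
  · simp

theorem lieRange_wordP (b : Bool) (w : List (Fin 7))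
    (h : ∀ u ∈ w.tails, ∀ n, comp (chevP b (u.headD 0)) (wordP b u.tail) n = none ∨
      comp (wordP b u.tail) (chevP b (u.headD 0)) n = none) :
    ((Int.castRingHom ℂ).mapMatrix (toM (wordP b w))).submatrix code code ∈ rep.range := by
  induction w with
  | nil =>
    rw [wordP, toM_none _ fun _ => rfl, map_zero, Matrix.submatrix_zero]
    exact zero_mem _
  | cons i w ih =>
    have hi : simpleOp b i ∈ rep.range := ⟨_, rep_simpleVec b i⟩
    rcases w with _ | ⟨j, w⟩
    · rw [wordP, ← simpleOp_eq]
      exact hi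
    · have ih := ih fun u hu => h u (by
        rw [List.tails]
        exact List.mem_cons_of_mem _ hu)
      have h0 : ∀ n, comp (chevP b i) (wordP b (j :: w)) n = none ∨
          comp (wordP b (j :: w)) (chevP b i) n = none := h (i :: j :: w) (by simp)
      rw [wordP]
      · rw [← toM_lieP _ _ h0]
        have := LieSubalgebra.lie_mem _ hi ih
        rw [simpleOp_eq] at this
        have h1 (A B : Matrix (Fin 56) (Fin 56) ℤ) :
            ⁅((Int.castRingHom ℂ).mapMatrix A).submatrix code code,
              ((Int.castRingHom ℂ).mapMatrix B).submatrix code code⁆ =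
            ((Int.castRingHom ℂ).mapMatrix ⁅A, B⁆).submatrix code code := by
          rw [Ring.lie_def, Ring.lie_def, map_sub, map_mul, map_mul, Matrix.submatrix_sub,
            Matrix.submatrix_mul_equiv, Matrix.submatrix_mul_equiv]
          rfl
        rw [h1] at this
        exact this
      · simp

theorem slOp_mem_range (b : Bool) (i : Fin 7) :
    (Int.castRingHom ℂ).mapMatrix (slOp i (sg b)) ∈ rep.range := by
  have h := lieRange_wordP b (slWord i) (check_slWord b i)
  have h1 : toM (wordP b (slWord i)) = slSign i • toM (slP b i) := by
    ext m n
    rw [Matrix.smul_apply, toM, check_slP, toM]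
    rcases slP b i n with _ | a
    · simp
    · simp
  have h2 : (Int.castRingHom ℂ).mapMatrix (slOp i (sg b)) = (slSign i : ℂ) •
      ((Int.castRingHom ℂ).mapMatrix (toM (wordP b (slWord i)))).submatrix code code := by
    -- The sign is its own inverse, so `slOp` is in turn the signed bracket.
    have h3 : (slSign i : ℂ) * slSign i = 1 := by
      unfold slSign
      split <;> simp
    rw [h1, slOp_eq]
    ext m n
    simp only [RingHom.mapMatrix_apply, Matrix.map_apply, Matrix.submatrix_apply,
      Matrix.smul_apply, smul_eq_mul, map_mul, eq_intCast]
    rw [← mul_assoc, h3, one_mul]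
  rw [h2]
  exact rep.range.smul_mem _ h

/-- The subalgebra `×_i 𝔰𝔩(A_i)` of `𝔢₇` acts on the tensor products in the natural way. -/
theorem exists_rep_eq_slAct (i : Fin 7) (X : Matrix (Fin 2) (Fin 2) ℂ) (hX : X.trace = 0) :
    ∃ x : LieAlgebra.e₇ ℂ, rep x = slAct i X := by
  change slAct i X ∈ rep.range
  have hX' : X 1 1 = -X 0 0 := by
    rw [Matrix.trace_fin_two] at hX
    linear_combination hX
  -- A traceless `X` is `X₀₁ e + X₁₀ f + X₀₀ h` with `h = ⁅e, f⁆`.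
  have h : slAct i X = X 0 1 • (Int.castRingHom ℂ).mapMatrix (slOp i (sg true)) +
      X 1 0 • (Int.castRingHom ℂ).mapMatrix (slOp i (sg false)) +
      X 0 0 • ⁅(Int.castRingHom ℂ).mapMatrix (slOp i (sg true)),
        (Int.castRingHom ℂ).mapMatrix (slOp i (sg false))⁆ := by
    rw [slAct_eq_sum, ← gen_lie, ← slUnit_diag, ← slUnit_offDiag, ← slUnit_offDiag, map_sub,
      smul_sub]
    simp only [Fin.sum_univ_two, hX', neg_smul, if_true, Bool.false_eq_true, if_false]
    abel
  rw [h]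
  exact add_mem (add_mem (rep.range.smul_mem _ (slOp_mem_range _ _))
    (rep.range.smul_mem _ (slOp_mem_range _ _)))
    (rep.range.smul_mem _ (LieSubalgebra.lie_mem _ (slOp_mem_range _ _) (slOp_mem_range _ _)))

end FanoE7

theorem mainTheorem7 :
    -- the `A_{ijk}` are the tensor products `A_i ⊗ A_j ⊗ A_k` for `×_i 𝔰𝔩(A_i) ⊆ 𝔢₇`
    (∀ (i : Fin 7) (X : Matrix (Fin 2) (Fin 2) ℂ), X.trace = 0 →
      ∃ x : LieAlgebra.e₇ ℂ, FanoE7.rep x = FanoE7.slAct i X) ∧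
    -- `Q` is the `E₇`-invariant quartic form
    ∃ Q : MvPolynomial FanoE7.Idx ℂ, Q.IsHomogeneous 4 ∧ Q ≠ 0 ∧
      (∀ q : MvPolynomial FanoE7.Idx ℂ, q.IsHomogeneous 4 →
        (FanoE7.IsE7Invariant q ↔ ∃ c : ℂ, q = c • Q)) ∧
      -- its restrictions to the factors are nonzero multiples of the hyperdeterminant
      (∀ ℓ : Fin 7, ∃ c : ℂ, c ≠ 0 ∧ FanoE7.RestrictsTo Q ℓ c) ∧
      -- it is characterized by Weyl invariance and by its restrictions to the factors
      (∀ q : MvPolynomial FanoE7.Idx ℂ, q.IsHomogeneous 4 →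
        ((FanoE7.IsWeylInvariant q ∧ ∀ ℓ : Fin 7, ∃ c : ℂ, FanoE7.RestrictsTo q ℓ c) ↔
          ∃ c : ℂ, q = c • Q)) := by
  refine ⟨FanoE7.exists_rep_eq_slAct, FanoE7.quartic, FanoE7.listPoly_isHomogeneous _,
    FanoE7.quartic_ne_zero, FanoE7.isE7Invariant_iff,
    fun l => ⟨1, one_ne_zero, FanoE7.quartic_restrictsTo l⟩,
    FanoE7.isWeylInvariant_and_restrictsTo_iff⟩
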